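/- **Conventions.** A magic unitary over a unital $C^*$-algebra $A$ is a matrix $u\in M_n(A)$ of projections such that each row and each column consists of pairwise orthogonal projections with sum $1$. A quantum permutation algebra is a pair $(A,u)$ of a unital $C^*$-algebra and a magic unitary $u\in M_n(A)$ whose entries generate $A$, such that $\Delta(u_{ij})=\sum_k u_{ik}\otimes u_{kj}$, $\varepsilon(u_{ij})=\delta_{ij}$, $S(u_{ij})=u_{ji}$ define morphisms $\Delta:A\to A\otimes A$, $\varepsilon:A\to\mathbb C$, $S:A\to A^{op}$, and which is full: $A$ is the enveloping $C^*$-algebra of the $*$-algebra generated by the $u_{ij}$. A magic decomposition of a Hilbert space $H$ is an $n\times n$ matrix $X$ of closed subspaces of $H$ each of whose rows and columns is an orthogonal decomposition of $H$ (zero subspaces are allowed); let $P_{ij}$ be the orthogonal projection onto $X_{ij}$. The Hopf image of $X$ is the final object $(A,u)$ among the quantum permutation algebras, with magic unitary of size $n$, for which $u_{ij}\mapsto P_{ij}$ defines a $*$-homomorphism $A\to B(H)$; that is, it is such an algebra, and every other such algebra $(B,v)$ has a $*$-homomorphism $B\to A$ with $v_{ij}\mapsto u_{ij}$. A magic partition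 of $I=\{1,\dots,N\}$ is an $n\times n$ matrix $E$ of subsets of $I$ each of whose rows and columns is a partition of $I$ (empty sets are allowed). Given an orthogonal decomposition $H=\bigoplus_{k=1}^N Y_k$ into closed subspaces, put $X^E_{ij}=\bigoplus_{k\in E_{ij}}Y_k$. For $k\in I$ let $\sigma_k\in S_n$ be the permutation with $\sigma_k(j)=i$ when $k\in E_{ij}$. **Theorem 2.8 (with Theorem 2.7).** Let $X$ be an $n\times n$ magic decomposition of a complex Hilbert space $H$. Then $X$ has a Hopf image, and for any Hopf image $(A,u)$ of $X$ the following are equivalent: 1. $A$ is commutative; 2. $X=X^E$ for some orthogonal decomposition $H=\bigoplus_{k=1}^N Y_k$ and some magic partition $E$ of $\{1,\dots,N\}$; 3. $X=X^E$ for some such decomposition with all $Y_k\neq 0$ and some magic partition $E$ of $\{1,\dots,N\}$. Moreover, whenever $X=X^E$ with all $Y_k\ne 0$, there is a $*$-isomorphism $A\simeq C(G)$ sending $u_{ij}$ to the characteristic function of $\{\sigma\in G\mid\sigma(j)=i\}$, where $G\subset S_n$ is the subgroup generated by $\sigma_1,\dots,\sigma_N$. -/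

import Mathlib

open scoped TensorProduct

universe w

noncomputable section

/-! ### C⋆-seminorms and C⋆-completions of unital complex ⋆-algebras -/

/-- A C⋆-seminorm on a unital complex ⋆-algebra. -/
structure CStarSeminorm (R : Type*) [Ring R] [StarRing R] [Algebra ℂ R] extends
    Seminorm ℂ R where
  mul_le' : ∀ x y : R, toSeminorm (x * y) ≤ toSeminorm x * toSeminorm y
  star_mul_self' : ∀ x : R, toSeminorm (star x * x) = toSeminorm x ^ 2

namespace CStarSeminorm

section Completion

variable {R : Type*} [Ring R] [StarRing R] [Algebra ℂ R]

instance : CoeFun (CStarSeminorm R) fun _ => R → ℝ := ⟨fun p => p.toSeminorm⟩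

variable (p : CStarSeminorm R)

instance : Inhabited (CStarSeminorm R) where
  default :=
    { toSeminorm := 0
      mul_le' := fun x y => by simp
      star_mul_self' := fun x => by simp }

theorem mul_le (x y : R) : p (x * y) ≤ p x * p y := p.mul_le' x y

theorem star_mul_self (x : R) : p (star x * x) = p x ^ 2 := p.star_mul_self' x

theorem nonneg (x : R) : 0 ≤ p x := apply_nonneg p.toSeminorm x

theorem le_star (x : R) : p x ≤ p (star x) := by
  have h := p.mul_le (star x) x
  rw [p.star_mul_self, sq] at h
  rcases (p.nonneg x).eq_or_lt with h0 | h0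
  · rw [← h0]; exact p.nonneg _
  · exact le_of_mul_le_mul_right h h0

theorem apply_star (x : R) : p (star x) = p x :=
  le_antisymm (by simpa using p.le_star (star x)) (p.le_star x)

/-- The ⋆-algebra `R`, equipped with the seminorm `p`. -/
def Carrier (_p : CStarSeminorm R) : Type _ := R

instance : SeminormedRing p.Carrier :=
  RingSeminorm.toSeminormedRing (R := R)
    { p.toSeminorm with mul_le' := p.mul_le' }

instance : StarRing p.Carrier := inferInstanceAs (StarRing R)

instance : Algebra ℂ p.Carrier := inferInstanceAs (Algebra ℂ R)

instance [StarModule ℂ R] : StarModule ℂ p.Carrier := inferInstanceAs (StarModule ℂ R)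

instance : NormedAlgebra ℂ p.Carrier where
  norm_smul_le c x := (map_smul_eq_mul p.toSeminorm c x).le

instance : NormedStarGroup p.Carrier where
  norm_star_le x := (p.apply_star x).le

theorem carrier_norm_star_mul_self (x : p.Carrier) : ‖star x * x‖ = ‖x‖ ^ 2 :=
  p.star_mul_self x

/-- The Hausdorff completion of `R` with respect to a C⋆-seminorm. -/
def Completion : Type _ := UniformSpace.Completion p.Carrier

namespace Completion

instance : NormedRing p.Completion :=
  inferInstanceAs (NormedRing (UniformSpace.Completion p.Carrier))

instance : CompleteSpace p.Completion :=
  inferInstanceAs (CompleteSpace (UniformSpace.Completion p.Carrier))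

instance : Algebra ℂ p.Completion :=
  inferInstanceAs (Algebra ℂ (UniformSpace.Completion p.Carrier))

instance : NormedAlgebra ℂ p.Completion where
  norm_smul_le c x := _root_.norm_smul_le (β := UniformSpace.Completion p.Carrier) c x

/-- The canonical map from `R` to its completion, as a plain function. -/
def mk (x : R) : p.Completion := @UniformSpace.Completion.coe' p.Carrier _ x

theorem denseRange_mk : DenseRange (mk p) :=
  UniformSpace.Completion.denseRange_coe (α := p.Carrier)

theorem norm_mk (x : R) : ‖mk p x‖ = p x := UniformSpace.Completion.norm_coe (E := p.Carrier) x

theorem mk_mul (x y : R) : mk p (x * y) = mk p x * mk p y :=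
  UniformSpace.Completion.coe_mul (α := p.Carrier) x y

theorem mk_add (x y : R) : mk p (x + y) = mk p x + mk p y :=
  UniformSpace.Completion.coe_add (α := p.Carrier) x y

theorem mk_smul (c : ℂ) (x : R) : mk p (c • x) = c • mk p x :=
  UniformSpace.Completion.coe_smul (X := p.Carrier) c x

instance : Star p.Completion where
  star := UniformSpace.Completion.map (star : p.Carrier → p.Carrier)

theorem uniformContinuous_star : UniformContinuous (star : p.Completion → p.Completion) :=
  UniformSpace.Completion.uniformContinuous_map (α := p.Carrier)

theorem mk_star (x : R) : mk p (star x) = star (mk p x) :=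
  (UniformSpace.Completion.map_coe (α := p.Carrier) (β := p.Carrier)
    (f := star) star_isometry.uniformContinuous x).symm

@[elab_as_elim]
theorem induction_on {P : p.Completion → Prop} (a : p.Completion)
    (hc : IsClosed {a | P a})
    (h : ∀ x : R, P (mk p x)) : P a :=
  UniformSpace.Completion.induction_on (α := p.Carrier) a hc h

instance : ContinuousStar p.Completion where
  continuous_star := (uniformContinuous_star p).continuous

instance : StarRing p.Completion where
  star_involutive a := by
    induction a using induction_on with
    | hc => exact isClosed_eq (by fun_prop) (by fun_prop)
    | h x => rw [← mk_star, ← mk_star, star_star]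
  star_add a b := by
    induction a using induction_on with
    | hc => exact isClosed_eq (by fun_prop) (by fun_prop)
    | h x =>
      induction b using induction_on with
      | hc => exact isClosed_eq (by fun_prop) (by fun_prop)
      | h y => rw [← mk_add, ← mk_star, ← mk_star, ← mk_star, ← mk_add, star_add]
  star_mul a b := by
    induction a using induction_on with
    | hc => exact isClosed_eq (by fun_prop) (by fun_prop)
    | h x =>
      induction b using induction_on with
      | hc => exact isClosed_eq (by fun_prop) (by fun_prop)
      | h y => rw [← mk_mul, ← mk_star, ← mk_star, ← mk_star, ← mk_mul, star_mul]

instance [StarModule ℂ R] : StarModule ℂ p.Completion where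
  star_smul c a := by
    induction a using induction_on with
    | hc =>
      exact isClosed_eq (continuous_star.comp (continuous_const_smul c))
        ((continuous_const_smul (star c)).comp continuous_star)
    | h x => rw [← mk_smul, ← mk_star, ← mk_star, ← mk_smul, star_smul]

instance : CStarRing p.Completion where
  norm_mul_self_le a := by
    induction a using induction_on with
    | hc => exact isClosed_le (by fun_prop) (by fun_prop)
    | h x => rw [← mk_star, ← mk_mul, norm_mk, norm_mk, p.star_mul_self, sq]

instance [StarModule ℂ R] : CStarAlgebra p.Completion where

/-- The canonical ⋆-homomorphism from `R` to its completion. -/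
def ofHom [StarModule ℂ R] : R →⋆ₐ[ℂ] p.Completion where
  toFun := mk p
  map_one' := rfl
  map_mul' := mk_mul p
  map_zero' := rfl
  map_add' := mk_add p
  commutes' c := by
    rw [Algebra.algebraMap_eq_smul_one, Algebra.algebraMap_eq_smul_one, mk_smul]; rfl
  map_star' := mk_star p

end Completion

end Completion

/-- The pullback of a C⋆-seminorm under a ⋆-homomorphism. -/
def comap {R R' : Type*} [Ring R] [StarRing R] [Algebra ℂ R] [Ring R'] [StarRing R']
    [Algebra ℂ R'] (p : CStarSeminorm R') (f : R →⋆ₐ[ℂ] R') : CStarSeminorm R where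
  toSeminorm := p.toSeminorm.comp f.toAlgHom.toLinearMap
  mul_le' x y := by simpa using! p.mul_le (f x) (f y)
  star_mul_self' x := by simpa [map_mul, map_star] using! p.star_mul_self (f x)

/-- Any C⋆-seminorm on a C⋆-algebra is dominated by the norm. -/
theorem le_norm {A : Type*} [CStarAlgebra A] (p : CStarSeminorm A) (a : A) : p a ≤ ‖a‖ := by
  rw [← Completion.norm_mk]
  exact NonUnitalStarAlgHom.norm_apply_le (Completion.ofHom p) a

end CStarSeminorm

/-! ### The tensor product of C⋆-algebras -/

section TensorProduct

variable (A B : Type*) [CStarAlgebra A] [CStarAlgebra B]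

/-- The inclusion `a ↦ a ⊗ 1` of the algebraic tensor product. -/
def tensorInclLeft : A →⋆ₐ[ℂ] A ⊗[ℂ] B where
  toAlgHom := Algebra.TensorProduct.includeLeft
  map_star' a := by simp

/-- The inclusion `b ↦ 1 ⊗ b` of the algebraic tensor product. -/
def tensorInclRight : B →⋆ₐ[ℂ] A ⊗[ℂ] B where
  toAlgHom := Algebra.TensorProduct.includeRight
  map_star' a := by simp

theorem CStarSeminorm.tmul_le (p : CStarSeminorm (A ⊗[ℂ] B)) (a : A) (b : B) :
    p (a ⊗ₜ b) ≤ ‖a‖ * ‖b‖ := by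
  have h : (a ⊗ₜ[ℂ] b) = tensorInclLeft A B a * tensorInclRight A B b := by
    change a ⊗ₜ[ℂ] b = (a ⊗ₜ 1) * (1 ⊗ₜ b)
    simp
  rw [h]
  exact (p.mul_le _ _).trans (mul_le_mul ((p.comap (tensorInclLeft A B)).le_norm a)
    ((p.comap (tensorInclRight A B)).le_norm b) (p.nonneg _) (norm_nonneg a))

theorem CStarSeminorm.bddAbove_tensor (x : A ⊗[ℂ] B) :
    BddAbove (Set.range fun p : CStarSeminorm (A ⊗[ℂ] B) => p x) := by
  induction x with
  | zero => exact ⟨0, by rintro _ ⟨p, rfl⟩; exact (map_zero p.toSeminorm).le⟩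
  | tmul a b => exact ⟨_, by rintro _ ⟨p, rfl⟩; exact p.tmul_le A B a b⟩
  | add x y hx hy =>
    obtain ⟨c, hc⟩ := hx
    obtain ⟨d, hd⟩ := hy
    refine ⟨c + d, ?_⟩
    rintro _ ⟨p, rfl⟩
    exact (map_add_le_add p.toSeminorm x y).trans (add_le_add (hc ⟨p, rfl⟩) (hd ⟨p, rfl⟩))

/-- The greatest C⋆-seminorm on the algebraic tensor product of two C⋆-algebras. -/
def maxCStarSeminorm : CStarSeminorm (A ⊗[ℂ] B) where
  toFun x := ⨆ p : CStarSeminorm (A ⊗[ℂ] B), p x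
  map_zero' := by simp
  add_le' x y := ciSup_le fun p => (map_add_le_add p.toSeminorm x y).trans
    (add_le_add (le_ciSup (CStarSeminorm.bddAbove_tensor A B x) p)
      (le_ciSup (CStarSeminorm.bddAbove_tensor A B y) p))
  neg' x := by simp
  smul' c x := by
    simp only [map_smul_eq_mul]
    exact (Real.mul_iSup_of_nonneg (norm_nonneg c) _).symm
  mul_le' x y := ciSup_le fun p => (p.mul_le x y).trans
    (mul_le_mul (le_ciSup (CStarSeminorm.bddAbove_tensor A B x) p)
      (le_ciSup (CStarSeminorm.bddAbove_tensor A B y) p) (p.nonneg y)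
      (Real.iSup_nonneg fun q => q.nonneg x))
  star_mul_self' x := by
    change ⨆ p : CStarSeminorm (A ⊗[ℂ] B), p (star x * x) =
      (⨆ p : CStarSeminorm (A ⊗[ℂ] B), p x) ^ 2
    simp only [CStarSeminorm.star_mul_self]
    exact (Real.iSup_pow (fun p : CStarSeminorm (A ⊗[ℂ] B) => p.nonneg x) 2).symm

/-- The (maximal) C⋆-tensor product of two unital C⋆-algebras: the completion of the algebraic
tensor product with respect to its greatest C⋆-seminorm. -/
abbrev CStarTensor : Type _ := (maxCStarSeminorm A B).Completion

variable {A B}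

/-- The elementary tensor `a ⊗ b` in the C⋆-tensor product. -/
def CStarTensor.tmul (a : A) (b : B) : CStarTensor A B :=
  CStarSeminorm.Completion.ofHom (maxCStarSeminorm A B) (a ⊗ₜ[ℂ] b)

end TensorProduct

/-! ### Magic unitaries and quantum permutation algebras -/

section Quantum

variable {n : ℕ} {A : Type*} [CStarAlgebra A]

/-- A finite family of pairwise orthogonal projections with sum `1`; some may vanish. -/
structure IsPartitionOfUnity {ι : Type*} [Fintype ι] (p : ι → A) : Prop where
  isStarProjection : ∀ i, IsStarProjection (p i)
  orthogonal : Pairwise fun i j => p i * p j = 0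
  sum_eq_one : ∑ i, p i = 1

/-- A magic unitary: all rows and all columns are partitions of unity. -/
structure IsMagicUnitary (u : Matrix (Fin n) (Fin n) A) : Prop where
  row : ∀ i, IsPartitionOfUnity fun j => u i j
  col : ∀ j, IsPartitionOfUnity fun i => u i j

/-- The ⋆-algebra generated by the entries of a matrix. -/
abbrev entryAlgebra (u : Matrix (Fin n) (Fin n) A) : StarSubalgebra ℂ A :=
  StarAlgebra.adjoin ℂ {a | ∃ i j, u i j = a}

/-- `(A, u)` is a (full) quantum permutation algebra.

Fullness says that `A` is the enveloping C⋆-algebra of the ⋆-algebra `𝒜` generated by the `u i j`: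
the norm of `A` is the greatest C⋆-seminorm on `𝒜`. For full algebras a comultiplication with
values in the maximal tensor product is the same thing as one with values in the minimal tensor
product, since it maps `𝒜` into the algebraic tensor product of `𝒜` with itself, and every
⋆-homomorphism from `𝒜` to a C⋆-algebra extends to `A`. -/
structure IsQuantumPermutationAlgebra (u : Matrix (Fin n) (Fin n) A) : Prop where
  isMagicUnitary : IsMagicUnitary u
  generates : (entryAlgebra u).topologicalClosure = ⊤
  full : ∀ (p : CStarSeminorm (entryAlgebra u)) (x : entryAlgebra u), p x ≤ ‖(x : A)‖
  comul : ∃ Δ : A →⋆ₐ[ℂ] CStarTensor A A,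
    ∀ i j, Δ (u i j) = ∑ k, CStarTensor.tmul (u i k) (u k j)
  counit : ∃ ε : A →⋆ₐ[ℂ] ℂ, ∀ i j, ε (u i j) = if i = j then 1 else 0
  antipode : ∃ S : A →⋆ₐ[ℂ] Aᵐᵒᵖ, ∀ i j, S (u i j) = MulOpposite.op (u j i)

end Quantum

/-! ### Magic decompositions and Hopf images -/

section Hopf

variable {H : Type*} [NormedAddCommGroup H] [InnerProductSpace ℂ H]

/-- A finite family of pairwise orthogonal closed subspaces with sum `H`; some may vanish. -/
structure IsOrthogonalDecomposition {ι : Type*} [Finite ι] (K : ι → Submodule ℂ H) : Prop where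
  isClosed : ∀ i, IsClosed (K i : Set H)
  orthogonal : Pairwise fun i j => K i ⟂ K j
  iSup_eq_top : ⨆ i, K i = ⊤

/-- A magic decomposition of `H`: all rows and columns are orthogonal decompositions of `H`. -/
structure MagicDecomposition (n : ℕ) (H : Type*) [NormedAddCommGroup H]
    [InnerProductSpace ℂ H] where
  space : Matrix (Fin n) (Fin n) (Submodule ℂ H)
  row : ∀ i, IsOrthogonalDecomposition fun j => space i j
  col : ∀ j, IsOrthogonalDecomposition fun i => space i j

variable [CompleteSpace H] {n : ℕ}

/-- The magic unitary of a magic decomposition: `P i j` is the orthogonal projection onto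
`X i j`. -/
def MagicDecomposition.proj (X : MagicDecomposition n H) : Matrix (Fin n) (Fin n) (H →L[ℂ] H) :=
  fun i j =>
    haveI : CompleteSpace (X.space i j) := ((X.row i).isClosed j).completeSpace_coe
    (X.space i j).starProjection

/-- `(A, u)` is a quantum permutation algebra through which the representation of the universal
algebra generated by an `n × n` magic unitary, mapping the generators to the projections `P i j`
onto the `X i j`, factorizes. (The morphism from the universal algebra to `A` maps generators to
the `u i j`, so a factorization is a ⋆-homomorphism mapping `u i j` to `P i j`.) -/
structure IsFactorization {A : Type*} [CStarAlgebra A] (X : MagicDecomposition n H)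
    (u : Matrix (Fin n) (Fin n) A) : Prop where
  isQuantumPermutationAlgebra : IsQuantumPermutationAlgebra u
  factors : ∃ ρ : A →⋆ₐ[ℂ] (H →L[ℂ] H), ∀ i j, ρ (u i j) = X.proj i j

/-- `(A, u)` is the Hopf image of the representation associated to `X`: the final object in the
category of its factorizations through quantum permutation algebras. The morphism `φ` is
automatically unique and compatible with the representations, because the `v i j` generate `B`. -/
structure IsHopfImage {A : Type w} [CStarAlgebra A] (X : MagicDecomposition n H)
    (u : Matrix (Fin n) (Fin n) A) : Prop where
  isFactorization : IsFactorization X u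
  final : ∀ (B : Type w) [CStarAlgebra B] (v : Matrix (Fin n) (Fin n) B),
    IsFactorization X v → ∃ φ : B →⋆ₐ[ℂ] A, ∀ i j, φ (v i j) = u i j

end Hopf

/-! ### Magic partitions -/

/-- A family of pairwise disjoint sets with union everything; some may be empty. -/
structure IsSetPartition {ι I : Type*} (s : ι → Set I) : Prop where
  disjoint : Pairwise fun i j => Disjoint (s i) (s j)
  iUnion_eq_univ : ⋃ i, s i = Set.univ

/-- A magic partition of `I`: all rows and columns are partitions of `I`. -/
structure MagicPartition (n : ℕ) (I : Type*) where
  block : Matrix (Fin n) (Fin n) (Set I)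
  row : ∀ i, IsSetPartition fun j => block i j
  col : ∀ j, IsSetPartition fun i => block i j

namespace MagicPartition

variable {n : ℕ} {I : Type*} (E : MagicPartition n I)

theorem exists_row (k : I) (i : Fin n) : ∃ j, k ∈ E.block i j :=
  Set.mem_iUnion.1 ((E.row i).iUnion_eq_univ ▸ Set.mem_univ k)

theorem exists_col (k : I) (j : Fin n) : ∃ i, k ∈ E.block i j :=
  Set.mem_iUnion.1 ((E.col j).iUnion_eq_univ ▸ Set.mem_univ k)

theorem eq_row {k : I} {i j j' : Fin n} (h : k ∈ E.block i j) (h' : k ∈ E.block i j') : j = j' :=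
  by_contra fun hne => Set.disjoint_left.1 ((E.row i).disjoint hne) h h'

theorem eq_col {k : I} {i i' j : Fin n} (h : k ∈ E.block i j) (h' : k ∈ E.block i' j) : i = i' :=
  by_contra fun hne => Set.disjoint_left.1 ((E.col j).disjoint hne) h h'

/-- The permutation `σ k`, given by `σ k j = i` when `k ∈ E i j`. -/
def perm (k : I) : Equiv.Perm (Fin n) where
  toFun j := (E.exists_col k j).choose
  invFun i := (E.exists_row k i).choose
  left_inv j := E.eq_row (E.exists_row k _).choose_spec (E.exists_col k j).choose_spec
  right_inv i := E.eq_col (E.exists_col k _).choose_spec (E.exists_row k i).choose_spec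

theorem perm_apply_eq_iff (k : I) (i j : Fin n) : E.perm k j = i ↔ k ∈ E.block i j :=
  ⟨fun h => h ▸ (E.exists_col k j).choose_spec, E.eq_col (E.exists_col k j).choose_spec⟩

/-- The group associated to `E`, generated by the permutations `σ k`. -/
def group : Subgroup (Equiv.Perm (Fin n)) := Subgroup.closure (Set.range E.perm)

/-- The matrix of subspaces `X^E`, with `X^E i j` the sum of the `Y k` with `k ∈ E i j`. -/
def subspaces {H : Type*} [NormedAddCommGroup H] [InnerProductSpace ℂ H]
    (Y : I → Submodule ℂ H) : Matrix (Fin n) (Fin n) (Submodule ℂ H) :=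
  fun i j => ⨆ k ∈ E.block i j, Y k

end MagicPartition

/-- The magic unitary over `C(G)`, for a group `G` of permutations: the characteristic functions of
the sets `{σ ∈ G | σ j = i}`. (All functions on the finite group `G` are continuous.) -/
def groupMagicUnitary {n : ℕ} (G : Subgroup (Equiv.Perm (Fin n))) :
    Matrix (Fin n) (Fin n) (G → ℂ) :=
  fun i j σ => if (σ : Equiv.Perm (Fin n)) j = i then 1 else 0

end

/-!
# Hopf images of magic decompositions

**Existence.** The Hopf image is defined by generators and relations. In the free ⋆-algebra on
`n²` self-adjoint generators, let `J` consist of the magic relations together with every element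
which vanishes in some factorization of `X` (`MagicDecomposition.hopfRelations`), and let `A` be
the enveloping C⋆-algebra for the relations `x = 0`, `x ∈ J`: the completion for the greatest
C⋆-seminorm vanishing on `J` (`FreeMatrixAlgebra.exists_isEnvelope`). This algebra is full. Since
factorizations are full, each maps to `A` (`IsEnvelope.exists_hom_from`). Conversely `A` maps to
any magic unitary to which all factorizations map (`IsEnvelope.exists_hom_to`); applied to
`∑ k, u i k ⊗ u k j`, to the identity matrix, to the opposite transpose of `u` and to the
projections `P i j`, this gives the comultiplication, the counit, the antipode and the factorization of `X`. In
each case the map from a factorization `B` is its own structure map followed by the map induced by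
`B → A`; for the comultiplication, this uses the functoriality of the maximal tensor product.

**Commutative Hopf images.** If `A` is commutative, expanding `∏ j, ∑ i, u i j = 1` shows that the
products `∏ j, u (σ j) j`, for `σ` a permutation, form a partition of unity of which `u` is a magic
partition (`IsMagicUnitary.exists_isPartitionOfUnity`); the ranges of their images in `B(H)` are the
required decomposition.

**The Hopf image of `X^E`.** The functional calculus of the decomposition `Y`, composed with
`k ↦ σ k`, makes `C(G)` a factorization of `X = X^E`, so finality gives a map `C(G) → A`, which is
onto. For injectivity, consider the permutations `σ` for which `u i j ↦ [σ j = i]` defines a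
character of `A`. They form a group, by the Hopf algebra structure of `A`
(`IsQuantumPermutationAlgebra.hasCharacter_of_mem_closure`), and it contains each `σ k`, because
the image of `A` in `B(H)` acts on a nonzero vector of `Y k` by such a character. Hence it
contains `G`, and the elements of `C(G)` are separated by the characters of `A`.
-/

noncomputable section

/-! ### C⋆-seminorms and the extension of ⋆-homomorphisms -/

section Extension

variable {R B C : Type*} [Ring R] [StarRing R] [Algebra ℂ R] [CStarAlgebra B] [CStarAlgebra C]

/-- A ⋆-homomorphism `f` extends along a ⋆-homomorphism `g` with dense range, not necessarily
injective, as soon as it is contractive for the seminorm `‖g x‖`. -/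
theorem exists_starAlgHom_extension {g : R →⋆ₐ[ℂ] B} (f : R →⋆ₐ[ℂ] C)
    (hg : DenseRange g) (h : ∀ x, ‖f x‖ ≤ ‖g x‖) : ∃ F : B →⋆ₐ[ℂ] C, ∀ x, F (g x) = f x := by
  let F : B →L[ℂ] C := f.toAlgHom.toLinearMap.extendOfNorm g.toAlgHom.toLinearMap
  have hFg : ∀ x, F (g x) = f x := fun x =>
    LinearMap.extendOfNorm_eq (f := f.toAlgHom.toLinearMap) (e := g.toAlgHom.toLinearMap)
      hg ⟨1, fun x => by simpa using h x⟩ x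
  have h1 : F 1 = 1 := by simpa using hFg 1
  refine ⟨{ toFun := F
            map_one' := h1
            map_mul' := fun a b => ?_
            map_zero' := map_zero F
            map_add' := map_add F
            commutes' := fun c => ?_
            map_star' := fun a => ?_ }, hFg⟩
  · refine hg.induction_on₂ (p := fun a b => F (a * b) = F a * F b)
      (isClosed_eq (by fun_prop) (by fun_prop)) (fun x y => ?_) a b
    rw [← map_mul, hFg, hFg, hFg, map_mul]
  · rw [Algebra.algebraMap_eq_smul_one, Algebra.algebraMap_eq_smul_one]
    exact (map_smul F c 1).trans (by rw [h1])
  · refine hg.induction_on (p := fun a => F (star a) = star (F a)) a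
      (isClosed_eq (by fun_prop) (by fun_prop)) (fun x => ?_)
    rw [← map_star, hFg, hFg, map_star]

namespace CStarSeminorm

/-- The norm of a C⋆-algebra, as a C⋆-seminorm. -/
def ofNorm (B : Type*) [CStarAlgebra B] : CStarSeminorm B where
  toSeminorm := normSeminorm ℂ B
  mul_le' x y := norm_mul_le x y
  star_mul_self' x := by
    simpa [sq] using! CStarRing.norm_star_mul_self (x := x)

theorem comap_ofNorm_apply (f : R →⋆ₐ[ℂ] B) (x : R) : (ofNorm B).comap f x = ‖f x‖ := rfl

theorem comap_apply {R' : Type*} [Ring R'] [StarRing R'] [Algebra ℂ R'] (p : CStarSeminorm R')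
    (f : R →⋆ₐ[ℂ] R') (x : R) : p.comap f x = p (f x) := rfl

/-- The pointwise supremum of a pointwise bounded family of C⋆-seminorms. -/
def iSup {ι : Type*} [Nonempty ι] (P : ι → CStarSeminorm R)
    (hP : ∀ x, BddAbove (Set.range fun i => P i x)) : CStarSeminorm R where
  toFun x := ⨆ i, P i x
  map_zero' := by simp
  add_le' x y := ciSup_le fun i => (map_add_le_add (P i).toSeminorm x y).trans
    (add_le_add (le_ciSup (hP x) i) (le_ciSup (hP y) i))
  neg' x := by simp
  smul' c x := by
    simp only [map_smul_eq_mul]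
    exact (Real.mul_iSup_of_nonneg (norm_nonneg c) _).symm
  mul_le' x y := ciSup_le fun i => ((P i).mul_le x y).trans
    (mul_le_mul (le_ciSup (hP x) i) (le_ciSup (hP y) i) ((P i).nonneg y)
      (Real.iSup_nonneg fun j => (P j).nonneg x))
  star_mul_self' x := by
    change ⨆ i, P i (star x * x) = (⨆ i, P i x) ^ 2
    simp only [CStarSeminorm.star_mul_self]
    exact (Real.iSup_pow (fun i => (P i).nonneg x) 2).symm

theorem iSup_apply {ι : Type*} [Nonempty ι] (P : ι → CStarSeminorm R)
    (hP : ∀ x, BddAbove (Set.range fun i => P i x)) (x : R) : iSup P hP x = ⨆ i, P i x := rfl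

/-- A C⋆-seminorm is at most `1` on elements which it sees as projections. -/
theorem le_one_of_isStarProjection (p : CStarSeminorm R) {x : R} (h1 : star x = x)
    (h2 : p (x * x - x) = 0) : p x ≤ 1 := by
  have h3 : p (x * x) ≤ p x := by
    have := map_add_le_add p.toSeminorm (x * x - x) x
    rw [sub_add_cancel, h2, zero_add] at this
    exact this
  have h4 : p x ^ 2 ≤ p x := by rw [← p.star_mul_self, h1]; exact h3
  nlinarith [p.nonneg x]

theorem map_one_le (p : CStarSeminorm R) : p 1 ≤ 1 :=
  p.le_one_of_isStarProjection (star_one R) (by simp)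

end CStarSeminorm

theorem CStarSeminorm.exists_extension [StarModule ℂ R] (p : CStarSeminorm R) (f : R →⋆ₐ[ℂ] C)
    (h : ∀ x, ‖f x‖ ≤ p x) :
    ∃ F : p.Completion →⋆ₐ[ℂ] C, ∀ x, F (CStarSeminorm.Completion.ofHom p x) = f x :=
  exists_starAlgHom_extension f (CStarSeminorm.Completion.denseRange_mk p)
    fun x => (h x).trans_eq (CStarSeminorm.Completion.norm_mk p x).symm

end Extension

/-! ### ⋆-homomorphisms on the maximal tensor product -/

namespace CStarTensor

variable {A B C : Type*} [CStarAlgebra A] [CStarAlgebra B] [CStarAlgebra C]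

/-- Every ⋆-homomorphism on the algebraic tensor product extends, because the pullback of the norm
of `C` is one of the seminorms over which `maxCStarSeminorm` is the supremum. -/
theorem exists_lift (f : A ⊗[ℂ] B →⋆ₐ[ℂ] C) :
    ∃ F : CStarTensor A B →⋆ₐ[ℂ] C, ∀ a b, F (tmul a b) = f (a ⊗ₜ b) := by
  obtain ⟨F, hF⟩ := (maxCStarSeminorm A B).exists_extension f fun x =>
    le_ciSup (CStarSeminorm.bddAbove_tensor A B x) ((CStarSeminorm.ofNorm C).comap f)
  exact ⟨F, fun a b => hF _⟩

theorem tmul_mul_tmul (a a' : A) (b b' : B) :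
    tmul a b * tmul a' b' = tmul (a * a') (b * b') := by
  simp only [tmul, ← map_mul, Algebra.TensorProduct.tmul_mul_tmul]

theorem star_tmul (a : A) (b : B) : star (tmul a b) = tmul (star a) (star b) := by
  simp only [tmul, ← map_star, TensorProduct.star_tmul]

theorem tmul_one_one : tmul (1 : A) (1 : B) = 1 := by
  simp only [tmul, ← Algebra.TensorProduct.one_def, map_one]

theorem tmul_sum {ι : Type*} (s : Finset ι) (a : A) (b : ι → B) :
    tmul a (∑ i ∈ s, b i) = ∑ i ∈ s, tmul a (b i) := by
  simp only [tmul, TensorProduct.tmul_sum, map_sum]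

theorem sum_tmul {ι : Type*} (s : Finset ι) (a : ι → A) (b : B) :
    tmul (∑ i ∈ s, a i) b = ∑ i ∈ s, tmul (a i) b := by
  simp only [tmul, TensorProduct.sum_tmul, map_sum]

@[simp]
theorem tmul_zero (a : A) : tmul a (0 : B) = 0 := by simp [tmul]

@[simp]
theorem zero_tmul (b : B) : tmul (0 : A) b = 0 := by simp [tmul]

theorem exists_map {A' B' : Type*} [CStarAlgebra A'] [CStarAlgebra B'] (f : A →⋆ₐ[ℂ] A')
    (g : B →⋆ₐ[ℂ] B') : ∃ F : CStarTensor A B →⋆ₐ[ℂ] CStarTensor A' B',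
      ∀ a b, F (tmul a b) = tmul (f a) (g b) := by
  let h : A ⊗[ℂ] B →⋆ₐ[ℂ] A' ⊗[ℂ] B' :=
    { Algebra.TensorProduct.map f.toAlgHom g.toAlgHom with
      map_star' := fun x => by
        induction x with
        | zero => simp
        | tmul a b => simp [map_star]
        | add x y hx hy => simp_all }
  obtain ⟨F, hF⟩ := exists_lift ((CStarSeminorm.Completion.ofHom (maxCStarSeminorm A' B')).comp h)
  exact ⟨F, fun a b => hF a b⟩

/-- The product of two characters is a character of the tensor product. -/
theorem exists_mul (χ : A →⋆ₐ[ℂ] ℂ) (ψ : B →⋆ₐ[ℂ] ℂ) : ∃ F : CStarTensor A B →⋆ₐ[ℂ] ℂ,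
      ∀ a b, F (tmul a b) = χ a * ψ b := by
  let h : A ⊗[ℂ] B →⋆ₐ[ℂ] ℂ :=
    { Algebra.TensorProduct.lift χ.toAlgHom ψ.toAlgHom (fun _ _ => .all _ _) with
      map_star' := fun x => by
        induction x with
        | zero => simp
        | tmul a b => simp [map_star]
        | add x y hx hy => simp_all }
  obtain ⟨F, hF⟩ := exists_lift h
  exact ⟨F, fun a b => hF a b⟩

end CStarTensor

/-! ### The free ⋆-algebra on self-adjoint generators -/

instance (ι : Type*) : StarModule ℝ (FreeAlgebra ℝ ι) where
  star_smul r x := by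
    rw [Algebra.smul_def, star_mul, FreeAlgebra.star_algebraMap, ← Algebra.commutes,
      ← Algebra.smul_def, star_trivial r]

/-- The complex ⋆-algebra freely generated by self-adjoint elements indexed by `ι`. It is the
complexification of the free real algebra, on which Mathlib's `star` fixes the generators. -/
abbrev FreeStarAlgebra (ι : Type*) : Type _ := ℂ ⊗[ℝ] FreeAlgebra ℝ ι

namespace FreeStarAlgebra

variable {ι : Type*}

instance : StarModule ℂ (FreeStarAlgebra ι) where
  star_smul c x := by
    induction x using TensorProduct.induction_on with
    | zero => simp
    | tmul a b => simp [TensorProduct.smul_tmul']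
    | add x y hx hy => simp_all

/-- The self-adjoint generators. -/
def gen (i : ι) : FreeStarAlgebra ι := 1 ⊗ₜ FreeAlgebra.ι ℝ i

theorem star_gen (i : ι) : star (gen i) = gen i := by
  simp [gen, TensorProduct.star_tmul]

@[elab_as_elim]
theorem induction {P : FreeStarAlgebra ι → Prop} (x : FreeStarAlgebra ι) (one : P 1)
    (gen : ∀ i, P (gen i)) (mul : ∀ x y, P x → P y → P (x * y))
    (add : ∀ x y, P x → P y → P (x + y)) (smul : ∀ (c : ℂ) x, P x → P (c • x)) : P x := by
  induction x using TensorProduct.induction_on with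
  | zero => simpa using smul 0 1 one
  | add x y hx hy => exact add x y hx hy
  | tmul c a =>
    have h : P (1 ⊗ₜ a) := by
      induction a using FreeAlgebra.induction with
      | grade0 r =>
        have : (1 : ℂ) ⊗ₜ[ℝ] algebraMap ℝ (FreeAlgebra ℝ ι) r = (r : ℂ) • 1 := by
          rw [Algebra.algebraMap_eq_smul_one, TensorProduct.tmul_smul, TensorProduct.smul_tmul',
            Algebra.TensorProduct.one_def, TensorProduct.smul_tmul']
          simp
        rw [this]
        exact smul _ _ one
      | grade1 i => exact gen i
      | mul a b ha hb => simpa using mul _ _ ha hb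
      | add a b ha hb => simpa [TensorProduct.tmul_add] using add _ _ ha hb
    simpa [TensorProduct.smul_tmul'] using smul c _ h

variable {C : Type*} [CStarAlgebra C]

/-- A family of self-adjoint elements of `C` induces a ⋆-homomorphism to `C`. -/
theorem exists_lift {v : ι → C} (hv : ∀ i, star (v i) = v i) :
    ∃ f : FreeStarAlgebra ι →⋆ₐ[ℂ] C, ∀ i, f (gen i) = v i := by
  let f : FreeStarAlgebra ι →ₐ[ℂ] C :=
    Algebra.TensorProduct.lift (Algebra.ofId ℂ C) (FreeAlgebra.lift ℝ v)
      fun c x => Algebra.commutes c _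
  have hf : ∀ i, f (gen i) = v i := fun i =>
    (Algebra.TensorProduct.lift_tmul _ _ _ _ _).trans (by simp)
  refine ⟨{ f with map_star' := fun x => ?_ }, hf⟩
  change f (star x) = star (f x)
  induction x using FreeStarAlgebra.induction with
  | one => simp
  | gen i => rw [star_gen, hf, hv]
  | mul x y hx hy => simp [hx, hy]
  | add x y hx hy => simp [hx, hy]
  | smul c x hx => simp [hx]

theorem hom_ext {f g : FreeStarAlgebra ι →⋆ₐ[ℂ] C} (h : ∀ i, f (gen i) = g (gen i)) : f = g := by
  ext x
  induction x using FreeStarAlgebra.induction with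
  | one => simp
  | gen i => exact h i
  | mul x y hx hy => simp [hx, hy]
  | add x y hx hy => simp [hx, hy]
  | smul c x hx => simp [hx]

/-- A bound on the generators bounds C⋆-seminorms at every element, uniformly. -/
theorem bddAbove_seminorm {P : CStarSeminorm (FreeStarAlgebra ι) → Prop}
    (hP : ∀ i p, P p → p (gen i) ≤ 1) (x : FreeStarAlgebra ι) :
    ∃ c : ℝ, ∀ p, P p → p x ≤ c := by
  induction x using FreeStarAlgebra.induction with
  | one => exact ⟨1, fun p _ => p.map_one_le⟩
  | gen i => exact ⟨1, hP i⟩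
  | mul x y hx hy =>
    obtain ⟨⟨c, hc⟩, d, hd⟩ := And.intro hx hy
    exact ⟨c * d, fun p hp => (p.mul_le x y).trans (mul_le_mul (hc p hp) (hd p hp) (p.nonneg y)
      ((p.nonneg x).trans (hc p hp)))⟩
  | add x y hx hy =>
    obtain ⟨⟨c, hc⟩, d, hd⟩ := And.intro hx hy
    exact ⟨c + d, fun p hp => (map_add_le_add p.toSeminorm x y).trans
      (add_le_add (hc p hp) (hd p hp))⟩
  | smul a x hx =>
    obtain ⟨c, hc⟩ := hx
    refine ⟨‖a‖ * c, fun p hp => (map_smul_eq_mul p.toSeminorm a x).trans_le ?_⟩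
    exact mul_le_mul_of_nonneg_left (hc p hp) (norm_nonneg a)

end FreeStarAlgebra

/-! ### Magic unitaries as representations of the free ⋆-algebra -/

/-- The free ⋆-algebra on the `n²` entries of a matrix, in an arbitrary universe. -/
abbrev FreeMatrixAlgebra (n : ℕ) : Type w := FreeStarAlgebra (ULift.{w} (Fin n × Fin n))

namespace FreeMatrixAlgebra

open CStarSeminorm

variable {n : ℕ} {C : Type*} [CStarAlgebra C]

/-- The generic matrix entry. -/
def entry (i j : Fin n) : FreeMatrixAlgebra.{w} n := FreeStarAlgebra.gen ⟨(i, j)⟩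

theorem star_entry (i j : Fin n) : star (entry.{w} i j) = entry i j := FreeStarAlgebra.star_gen _

theorem exists_lift {v : Matrix (Fin n) (Fin n) C} (hv : ∀ i j, star (v i j) = v i j) :
    ∃ f : FreeMatrixAlgebra.{w} n →⋆ₐ[ℂ] C, ∀ i j, f (entry i j) = v i j := by
  obtain ⟨f, hf⟩ := FreeStarAlgebra.exists_lift (ι := ULift.{w} (Fin n × Fin n))
    (v := fun x => v x.down.1 x.down.2) fun x => hv _ _
  exact ⟨f, fun i j => hf _⟩

theorem hom_ext {f g : FreeMatrixAlgebra.{w} n →⋆ₐ[ℂ] C}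
    (h : ∀ i j, f (entry i j) = g (entry i j)) : f = g :=
  FreeStarAlgebra.hom_ext fun x => h x.down.1 x.down.2

/-- The elements of the free ⋆-algebra which have to vanish for the generic matrix to become a
magic unitary. -/
inductive MagicRelation (n : ℕ) : FreeMatrixAlgebra.{w} n → Prop
  | idem (i j) : MagicRelation n (entry i j * entry i j - entry i j)
  | row_orthogonal (i j k) (h : j ≠ k) : MagicRelation n (entry i j * entry i k)
  | col_orthogonal (i j k) (h : j ≠ k) : MagicRelation n (entry j i * entry k i)
  | row_sum (i) : MagicRelation n (∑ j, entry i j - 1)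
  | col_sum (i) : MagicRelation n (∑ j, entry j i - 1)

theorem isMagicUnitary_iff (f : FreeMatrixAlgebra.{w} n →⋆ₐ[ℂ] C) :
    IsMagicUnitary (fun i j => f (entry i j)) ↔ ∀ x, MagicRelation n x → f x = 0 := by
  constructor
  · rintro h _ (⟨i, j⟩ | ⟨i, j, k, hjk⟩ | ⟨i, j, k, hjk⟩ | i | i)
    · rw [map_sub, map_mul, sub_eq_zero]
      exact ((h.row i).isStarProjection j).isIdempotentElem
    · rw [map_mul]
      exact (h.row i).orthogonal hjk
    · rw [map_mul]
      exact (h.col i).orthogonal hjk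
    · rw [map_sub, map_sum, map_one, sub_eq_zero]
      exact (h.row i).sum_eq_one
    · rw [map_sub, map_sum, map_one, sub_eq_zero]
      exact (h.col i).sum_eq_one
  · intro h
    have hp : ∀ i j, IsStarProjection (f (entry i j)) := fun i j =>
      { isIdempotentElem := by
          have := h _ (.idem i j)
          rwa [map_sub, map_mul, sub_eq_zero] at this
        isSelfAdjoint := by
          rw [IsSelfAdjoint, ← map_star, star_entry] }
    refine ⟨fun i => ⟨fun j => hp i j, fun j k hjk => ?_, ?_⟩,
      fun i => ⟨fun j => hp j i, fun j k hjk => ?_, ?_⟩⟩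
    · simpa using h _ (.row_orthogonal i j k hjk)
    · simpa [sub_eq_zero] using h _ (.row_sum i)
    · simpa using h _ (.col_orthogonal i j k hjk)
    · simpa [sub_eq_zero] using h _ (.col_sum i)

/-- The greatest C⋆-seminorm on the free ⋆-algebra vanishing on a set of relations, which include
the magic relations. -/
theorem exists_greatest_seminorm (J : Set (FreeMatrixAlgebra.{w} n))
    (hJ : ∀ x, MagicRelation n x → x ∈ J) :
    ∃ p : CStarSeminorm (FreeMatrixAlgebra.{w} n), (∀ x ∈ J, p x = 0) ∧
      ∀ q : CStarSeminorm (FreeMatrixAlgebra.{w} n), (∀ x ∈ J, q x = 0) → ∀ x, q x ≤ p x := by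
  have hb := FreeStarAlgebra.bddAbove_seminorm
    (P := fun q : CStarSeminorm (FreeMatrixAlgebra.{w} n) => ∀ x ∈ J, q x = 0)
    fun i q hq => q.le_one_of_isStarProjection (FreeStarAlgebra.star_gen i)
      (hq _ (hJ _ (.idem i.down.1 i.down.2)))
  let P : {q : CStarSeminorm (FreeMatrixAlgebra.{w} n) // ∀ x ∈ J, q x = 0} →
    CStarSeminorm (FreeMatrixAlgebra.{w} n) := Subtype.val
  have : Nonempty {q : CStarSeminorm (FreeMatrixAlgebra.{w} n) // ∀ x ∈ J, q x = 0} :=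
    ⟨⟨default, fun _ _ => rfl⟩⟩
  have hP : ∀ x, BddAbove (Set.range fun i => P i x) := fun x => by
    obtain ⟨c, hc⟩ := hb x
    exact ⟨c, by rintro _ ⟨q, rfl⟩; exact hc q.1 q.2⟩
  refine ⟨.iSup P hP, fun x hx => ?_, fun q hq x => le_ciSup (hP x) ⟨q, hq⟩⟩
  rw [CStarSeminorm.iSup_apply]
  exact (iSup_congr fun q => q.2 x hx).trans (by simp)

end FreeMatrixAlgebra

/-- `f` exhibits `A` as the enveloping C⋆-algebra of `R` subject to the relations `x = 0` for
`x ∈ J`. -/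
structure IsEnvelope {R A : Type*} [Ring R] [StarRing R] [Algebra ℂ R] [CStarAlgebra A]
    (J : Set R) (f : R →⋆ₐ[ℂ] A) : Prop where
  denseRange : DenseRange f
  map_eq_zero : ∀ x ∈ J, f x = 0
  le_norm : ∀ q : CStarSeminorm R, (∀ x ∈ J, q x = 0) → ∀ x, q x ≤ ‖f x‖

theorem IsEnvelope.exists_lift {R A C : Type*} [Ring R] [StarRing R] [Algebra ℂ R] [CStarAlgebra A]
    [CStarAlgebra C] {J : Set R} {f : R →⋆ₐ[ℂ] A} (hf : IsEnvelope J f) (g : R →⋆ₐ[ℂ] C)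
    (hg : ∀ x ∈ J, g x = 0) : ∃ F : A →⋆ₐ[ℂ] C, ∀ x, F (f x) = g x :=
  exists_starAlgHom_extension g hf.denseRange
    (hf.le_norm ((CStarSeminorm.ofNorm C).comap g) fun x hx => by
      rw [CStarSeminorm.comap_ofNorm_apply, hg x hx, norm_zero])

namespace FreeMatrixAlgebra

variable {n : ℕ}

/-- Enveloping C⋆-algebras exist: the completion for the greatest C⋆-seminorm vanishing on `J`. -/
theorem exists_isEnvelope (J : Set (FreeMatrixAlgebra.{w} n))
    (hJ : ∀ x, MagicRelation n x → x ∈ J) :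
    ∃ (A : Type w) (_ : CStarAlgebra A) (f : FreeMatrixAlgebra.{w} n →⋆ₐ[ℂ] A),
      IsEnvelope J f := by
  obtain ⟨p, hp, hmax⟩ := exists_greatest_seminorm J hJ
  have hg : ∀ x, ‖CStarSeminorm.Completion.ofHom p x‖ = p x := CStarSeminorm.Completion.norm_mk p
  exact ⟨p.Completion, inferInstance, CStarSeminorm.Completion.ofHom p,
    CStarSeminorm.Completion.denseRange_mk p,
    fun x hx => norm_eq_zero.1 ((hg x).trans (hp x hx)),
    fun q hq x => (hmax q hq x).trans_eq (hg x).symm⟩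

variable {A : Type*} [CStarAlgebra A] (f : FreeMatrixAlgebra.{w} n →⋆ₐ[ℂ] A)

theorem apply_mem_entryAlgebra (x : FreeMatrixAlgebra.{w} n) :
    f x ∈ entryAlgebra (fun i j => f (entry i j)) := by
  induction x using FreeStarAlgebra.induction with
  | one => rw [map_one]; exact one_mem _
  | gen i => exact StarAlgebra.subset_adjoin _ _ ⟨i.down.1, i.down.2, rfl⟩
  | mul x y hx hy => rw [map_mul]; exact mul_mem hx hy
  | add x y hx hy => rw [map_add]; exact add_mem hx hy
  | smul c x hx =>
    rw [map_smul]
    exact (entryAlgebra fun i j => f (entry i j)).toSubalgebra.smul_mem hx c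

/-- The free ⋆-algebra maps onto the ⋆-algebra generated by the images of the entries. -/
def toEntryAlgebra :
    FreeMatrixAlgebra.{w} n →⋆ₐ[ℂ] entryAlgebra (fun i j => f (entry i j)) :=
  f.codRestrict _ (apply_mem_entryAlgebra f)

theorem toEntryAlgebra_surjective : Function.Surjective (toEntryAlgebra f) := by
  have h : entryAlgebra (fun i j => f (entry i j)) ≤ f.range :=
    StarAlgebra.adjoin_le (by rintro _ ⟨i, j, rfl⟩; exact ⟨entry i j, rfl⟩)
  rintro ⟨a, ha⟩
  obtain ⟨x, rfl⟩ := h ha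
  exact ⟨x, rfl⟩

theorem denseRange_iff :
    DenseRange f ↔ (entryAlgebra (fun i j => f (entry i j))).topologicalClosure = ⊤ := by
  have h : Set.range f = entryAlgebra (fun i j => f (entry i j)) := by
    ext a
    refine ⟨?_, fun ha => ?_⟩
    · rintro ⟨x, rfl⟩
      exact apply_mem_entryAlgebra f x
    · obtain ⟨x, hx⟩ := toEntryAlgebra_surjective f ⟨a, ha⟩
      exact ⟨x, congrArg Subtype.val hx⟩
  rw [DenseRange, h, ← SetLike.coe_set_eq, StarSubalgebra.topologicalClosure_coe,
    StarSubalgebra.coe_top, dense_iff_closure_eq]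

/-- An enveloping C⋆-algebra of the free ⋆-algebra is full: a C⋆-seminorm on the generated ⋆-algebra
pulls back to one which vanishes on `J`. -/
theorem _root_.IsEnvelope.full {f : FreeMatrixAlgebra.{w} n →⋆ₐ[ℂ] A}
    {J : Set (FreeMatrixAlgebra.{w} n)} (hf : IsEnvelope J f)
    (p : CStarSeminorm (entryAlgebra fun i j => f (entry i j)))
    (x : entryAlgebra fun i j => f (entry i j)) : p x ≤ ‖(x : A)‖ := by
  obtain ⟨x, rfl⟩ := toEntryAlgebra_surjective f x
  refine hf.le_norm (p.comap (toEntryAlgebra f)) (fun y hy => ?_) x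
  have : toEntryAlgebra f y = 0 := Subtype.ext (hf.map_eq_zero y hy)
  rw [CStarSeminorm.comap_apply, this]
  exact map_zero p.toSeminorm

/-- A full algebra is the enveloping C⋆-algebra of the free ⋆-algebra subject to all relations
satisfied by the entries of its magic unitary. -/
theorem isEnvelope_of_full
    (hdense : (entryAlgebra fun i j => f (entry i j)).topologicalClosure = ⊤)
    (hfull : ∀ (p : CStarSeminorm (entryAlgebra fun i j => f (entry i j)))
      (x : entryAlgebra fun i j => f (entry i j)), p x ≤ ‖(x : A)‖) :
    IsEnvelope {x | f x = 0} f := by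
  refine ⟨(denseRange_iff f).2 hdense, fun _ h => h, fun q hq x => ?_⟩
  -- A seminorm vanishing on the kernel of `f` descends along the surjection `toEntryAlgebra f`.
  obtain ⟨s, hs⟩ := (toEntryAlgebra_surjective f).hasRightInverse
  have hq' : ∀ {x y}, f x = f y → q x = q y := fun {x y} h => by
    have h0 : q (x - y) = 0 := hq _ (by simp [h])
    refine le_antisymm ?_ ?_
    · have := map_add_le_add q.toSeminorm (x - y) y
      rwa [h0, zero_add, sub_add_cancel] at this
    · have := map_sub_le_add q.toSeminorm x (x - y)
      rwa [h0, add_zero, sub_sub_cancel] at this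
  have hfs : ∀ y, f (s y) = y := fun y => congrArg Subtype.val (hs y)
  let p : CStarSeminorm (entryAlgebra fun i j => f (entry i j)) :=
    { toFun := fun y => q (s y)
      map_zero' := (hq' (by rw [hfs, map_zero]; rfl)).trans (map_zero q.toSeminorm)
      add_le' := fun y z => (hq' (y := s y + s z) (by simp [hfs])).trans_le
        (map_add_le_add q.toSeminorm _ _)
      neg' := fun y => (hq' (y := - s y) (by simp [hfs])).trans (map_neg_eq_map q.toSeminorm _)
      smul' := fun c y => (hq' (y := c • s y) (by simp [hfs])).trans
        (map_smul_eq_mul q.toSeminorm _ _)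
      mul_le' := fun y z => (hq' (y := s y * s z) (by simp [hfs])).trans_le (q.mul_le _ _)
      star_mul_self' := fun y => (hq' (y := star (s y) * s y) (by simp [hfs, map_star])).trans
        (q.star_mul_self _) }
  exact (hq' (hfs (toEntryAlgebra f x)).symm).trans_le (hfull p (toEntryAlgebra f x))

end FreeMatrixAlgebra

theorem IsMagicUnitary.star_eq {n : ℕ} {A : Type*} [CStarAlgebra A] {u : Matrix (Fin n) (Fin n) A}
    (hu : IsMagicUnitary u) (i j : Fin n) : star (u i j) = u i j :=
  ((hu.row i).isStarProjection j).isSelfAdjoint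

/-! ### Partitions of unity and magic unitaries -/

section PartitionOfUnity

variable {A B : Type*} [CStarAlgebra A] [CStarAlgebra B] {ι κ : Type*} [Fintype ι] [Fintype κ]

namespace IsPartitionOfUnity

theorem star_eq {q : ι → A} (hq : IsPartitionOfUnity q) (i : ι) : star (q i) = q i :=
  (hq.isStarProjection i).isSelfAdjoint

theorem mul_eq [DecidableEq ι] {q : ι → A} (hq : IsPartitionOfUnity q) (i j : ι) :
    q i * q j = if i = j then q i else 0 := by
  split_ifs with h
  · subst h
    exact (hq.isStarProjection i).isIdempotentElem
  · exact hq.orthogonal h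

theorem of_mul_eq [DecidableEq ι] {q : ι → A} (h1 : ∀ i, star (q i) = q i)
    (h2 : ∀ i j, q i * q j = if i = j then q i else 0) (h3 : ∑ i, q i = 1) :
    IsPartitionOfUnity q where
  isStarProjection i := ⟨(h2 i i).trans (if_pos rfl), h1 i⟩
  orthogonal i j hij := (h2 i j).trans (if_neg hij)
  sum_eq_one := h3

theorem tmul {q : ι → A} {r : κ → B} (hq : IsPartitionOfUnity q) (hr : IsPartitionOfUnity r) :
    IsPartitionOfUnity fun x : ι × κ => CStarTensor.tmul (q x.1) (r x.2) := by
  classical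
  refine .of_mul_eq (fun x => ?_) (fun x y => ?_) ?_
  · rw [CStarTensor.star_tmul, hq.star_eq, hr.star_eq]
  · rw [CStarTensor.tmul_mul_tmul, hq.mul_eq, hr.mul_eq]
    split_ifs <;> simp_all [Prod.ext_iff]
  · simp only [Fintype.sum_prod_type, ← CStarTensor.tmul_sum, ← CStarTensor.sum_tmul,
      hq.sum_eq_one, hr.sum_eq_one, CStarTensor.tmul_one_one]

/-- Functional calculus: the ⋆-homomorphism `f ↦ ∑ i, f i • q i` for a partition of unity `q`. -/
def lift {q : ι → A} (hq : IsPartitionOfUnity q) : (ι → ℂ) →⋆ₐ[ℂ] A where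
  toFun f := ∑ i, f i • q i
  map_one' := by simp [hq.sum_eq_one]
  map_mul' f g := by
    classical
    simp [Finset.sum_mul, Finset.mul_sum, hq.mul_eq, smul_smul, mul_comm]
  map_zero' := by simp
  map_add' f g := by simp [add_smul, Finset.sum_add_distrib]
  commutes' c := by
    simp [Algebra.algebraMap_eq_smul_one, ← Finset.smul_sum, hq.sum_eq_one]
  map_star' f := by simp [star_sum, hq.star_eq]

theorem lift_apply {q : ι → A} (hq : IsPartitionOfUnity q) (f : ι → ℂ) :
    hq.lift f = ∑ i, f i • q i := rfl

end IsPartitionOfUnity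

theorem IsPartitionOfUnity.map {A B : Type*} [CStarAlgebra A] [CStarAlgebra B] {ι : Type*}
    [Fintype ι] {q : ι → A} (hq : IsPartitionOfUnity q) (f : A →⋆ₐ[ℂ] B) :
    IsPartitionOfUnity fun i => f (q i) where
  isStarProjection i := (hq.isStarProjection i).map f
  orthogonal i j hij := by
    change f (q i) * f (q j) = 0
    rw [← map_mul, hq.orthogonal hij, map_zero]
  sum_eq_one := by rw [← map_sum, hq.sum_eq_one, map_one]

theorem IsPartitionOfUnity.reindex {A : Type*} [CStarAlgebra A] {ι κ : Type*}
    [Fintype ι] [Fintype κ] {q : ι → A} (hq : IsPartitionOfUnity q) (e : κ ≃ ι) :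
    IsPartitionOfUnity fun i => q (e i) where
  isStarProjection i := hq.isStarProjection _
  orthogonal i j hij := hq.orthogonal (e.injective.ne hij)
  sum_eq_one := by rw [e.sum_comp q, hq.sum_eq_one]

end PartitionOfUnity

namespace IsMagicUnitary

variable {A B : Type*} [CStarAlgebra A] [CStarAlgebra B] {n : ℕ}

theorem row_mul {u : Matrix (Fin n) (Fin n) A} (hu : IsMagicUnitary u) (i j k : Fin n) :
    u i j * u i k = if j = k then u i j else 0 := (hu.row i).mul_eq j k

theorem col_mul {u : Matrix (Fin n) (Fin n) A} (hu : IsMagicUnitary u) (i j k : Fin n) :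
    u j i * u k i = if j = k then u j i else 0 := (hu.col i).mul_eq j k

/-- Convolution of magic unitaries. -/
theorem conv {u : Matrix (Fin n) (Fin n) A} {v : Matrix (Fin n) (Fin n) B} (hu : IsMagicUnitary u)
    (hv : IsMagicUnitary v) :
    IsMagicUnitary fun i j => ∑ k, CStarTensor.tmul (u i k) (v k j) := by
  have hs : ∀ i j, star (∑ k, CStarTensor.tmul (u i k) (v k j)) =
      ∑ k, CStarTensor.tmul (u i k) (v k j) := fun i j => by
    simp only [star_sum, CStarTensor.star_tmul, hu.star_eq, hv.star_eq]
  refine ⟨fun i => .of_mul_eq (hs i) (fun j j' => ?_) ?_,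
    fun j => .of_mul_eq (fun i => hs i j) (fun i i' => ?_) ?_⟩
  · simp only [Finset.sum_mul_sum, CStarTensor.tmul_mul_tmul, hu.row_mul]
    rw [Finset.sum_congr rfl fun k _ => Finset.sum_eq_single k (fun l _ h => by simp [h.symm])
      (by simp)]
    simp only [if_true, hv.row_mul]
    split_ifs <;> simp
  · rw [Finset.sum_comm]
    simp only [← CStarTensor.tmul_sum, ← CStarTensor.sum_tmul, (hu.row i).sum_eq_one,
      (hv.row _).sum_eq_one, CStarTensor.tmul_one_one]
  · simp only [Finset.sum_mul_sum, CStarTensor.tmul_mul_tmul, hv.col_mul]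
    rw [Finset.sum_congr rfl fun k _ => Finset.sum_eq_single k (fun l _ h => by simp [h.symm])
      (by simp)]
    simp only [if_true, hu.col_mul]
    split_ifs <;> simp
  · rw [Finset.sum_comm]
    simp only [← CStarTensor.tmul_sum, ← CStarTensor.sum_tmul, (hv.col j).sum_eq_one,
      (hu.col _).sum_eq_one, CStarTensor.tmul_one_one]

theorem op_transpose {u : Matrix (Fin n) (Fin n) A} (hu : IsMagicUnitary u) :
    IsMagicUnitary fun i j => MulOpposite.op (u j i) := by
  have hs : ∀ i j, star (MulOpposite.op (u j i)) = MulOpposite.op (u j i) := fun i j => by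
    rw [← MulOpposite.op_star, hu.star_eq]
  refine ⟨fun i => .of_mul_eq (hs i) (fun j j' => ?_) ?_,
    fun j => .of_mul_eq (fun i => hs i j) (fun i i' => ?_) ?_⟩
  · rw [← MulOpposite.op_mul, (hu.col i).mul_eq]
    split_ifs with h1 h2 h2 <;> simp_all
  · rw [← Finset.op_sum, (hu.col i).sum_eq_one, MulOpposite.op_one]
  · rw [← MulOpposite.op_mul, (hu.row j).mul_eq]
    split_ifs with h1 h2 h2 <;> simp_all
  · rw [← Finset.op_sum, (hu.row j).sum_eq_one, MulOpposite.op_one]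

end IsMagicUnitary

theorem isMagicUnitary_one (n : ℕ) :
    IsMagicUnitary (fun i j : Fin n => if i = j then (1 : ℂ) else 0) := by
  refine ⟨fun i => .of_mul_eq ?_ ?_ ?_, fun i => .of_mul_eq ?_ ?_ ?_⟩
  · intro j; split_ifs <;> simp
  · intro j k; split_ifs <;> simp_all
  · simp
  · intro j; split_ifs <;> simp
  · intro j k; split_ifs <;> simp_all
  · simp

/-! ### Existence of the Hopf image -/

section Existence

variable {H : Type*} [NormedAddCommGroup H] [InnerProductSpace ℂ H] [CompleteSpace H] {n : ℕ}

/-- A ⋆-homomorphism, viewed between the opposite algebras. -/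
def StarAlgHom.opHom {A B : Type*} [CStarAlgebra A] [CStarAlgebra B] (φ : A →⋆ₐ[ℂ] B) :
    Aᵐᵒᵖ →⋆ₐ[ℂ] Bᵐᵒᵖ where
  toAlgHom := AlgHom.op φ.toAlgHom
  map_star' x := by
    apply MulOpposite.unop_injective
    exact map_star φ x.unop

theorem StarAlgHom.opHom_op {A B : Type*} [CStarAlgebra A] [CStarAlgebra B] (φ : A →⋆ₐ[ℂ] B)
    (a : A) : φ.opHom (MulOpposite.op a) = MulOpposite.op (φ a) := rfl

open FreeMatrixAlgebra in
/-- By fullness, a map from a quantum permutation algebra exists as soon as the relations between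
its entries are respected. -/
theorem IsQuantumPermutationAlgebra.exists_hom {A B : Type*} [CStarAlgebra A] [CStarAlgebra B]
    (f : FreeMatrixAlgebra.{w} n →⋆ₐ[ℂ] A) (g : FreeMatrixAlgebra.{w} n →⋆ₐ[ℂ] B)
    (hg : IsQuantumPermutationAlgebra fun i j => g (entry i j)) (h : ∀ x, g x = 0 → f x = 0) :
    ∃ φ : B →⋆ₐ[ℂ] A, ∀ i j, φ (g (entry i j)) = f (entry i j) := by
  obtain ⟨φ, hφ⟩ := (isEnvelope_of_full g hg.generates hg.full).exists_lift f h
  exact ⟨φ, fun i j => hφ _⟩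

open FreeMatrixAlgebra

/-- The relations imposed on the free ⋆-algebra to obtain the Hopf image: the magic relations, and
all relations which hold in some factorization of `X`. -/
def MagicDecomposition.hopfRelations (X : MagicDecomposition n H) :
    Set (FreeMatrixAlgebra.{w} n) :=
  {x | MagicRelation n x ∨
    ∃ (B : Type w) (_ : CStarAlgebra B) (g : FreeMatrixAlgebra.{w} n →⋆ₐ[ℂ] B),
      IsFactorization X (fun i j => g (entry i j)) ∧ g x = 0}

variable {X : MagicDecomposition n H} {A : Type w} [CStarAlgebra A]
  {f : FreeMatrixAlgebra.{w} n →⋆ₐ[ℂ] A}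

theorem IsEnvelope.isMagicUnitary (hf : IsEnvelope X.hopfRelations f) :
    IsMagicUnitary fun i j => f (entry i j) :=
  (isMagicUnitary_iff f).2 fun x hx => hf.map_eq_zero x (Or.inl hx)

/-- Every factorization maps to the algebra defined by the relations `X.hopfRelations`. -/
theorem IsEnvelope.exists_hom_from (hf : IsEnvelope X.hopfRelations f)
    {B : Type w} [CStarAlgebra B] {v : Matrix (Fin n) (Fin n) B} (hv : IsFactorization X v) :
    ∃ φ : B →⋆ₐ[ℂ] A, ∀ i j, φ (v i j) = f (entry i j) := by
  obtain ⟨g, hg⟩ := FreeMatrixAlgebra.exists_lift.{w}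
    hv.isQuantumPermutationAlgebra.isMagicUnitary.star_eq
  obtain rfl : (fun i j => g (entry i j)) = v := funext₂ hg
  exact hv.isQuantumPermutationAlgebra.exists_hom f g
    fun x hx => hf.map_eq_zero x (Or.inr ⟨B, _, g, hv, hx⟩)

/-- The algebra defined by the relations `X.hopfRelations` maps to every magic unitary to which all
factorizations map. -/
theorem IsEnvelope.exists_hom_to {C : Type*} [CStarAlgebra C] (hf : IsEnvelope X.hopfRelations f)
    {z : Matrix (Fin n) (Fin n) C} (hz : IsMagicUnitary z)
    (h : ∀ (B : Type w) [CStarAlgebra B] (v : Matrix (Fin n) (Fin n) B),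
      IsFactorization X v → ∃ φ : B →⋆ₐ[ℂ] C, ∀ i j, φ (v i j) = z i j) :
    ∃ φ : A →⋆ₐ[ℂ] C, ∀ i j, φ (f (entry i j)) = z i j := by
  obtain ⟨g, hg⟩ := FreeMatrixAlgebra.exists_lift.{w} hz.star_eq
  obtain rfl : (fun i j => g (entry i j)) = z := funext₂ hg
  obtain ⟨φ, hφ⟩ := hf.exists_lift g fun x hx => by
    rcases hx with hx | ⟨B, _, k, hk, hx⟩
    · exact (isMagicUnitary_iff g).1 hz x hx
    · obtain ⟨ψ, hψ⟩ := h B _ hk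
      rw [← FreeMatrixAlgebra.hom_ext (f := ψ.comp k) (g := g) hψ, StarAlgHom.comp_apply, hx,
        map_zero]
  exact ⟨φ, fun i j => hφ _⟩

/-- The structure maps of all factorizations induce those of the Hopf image: the product of the
canonical map with itself, or with its opposite, turns the structure maps of a factorization into
maps to the required magic unitary. -/
theorem IsEnvelope.isHopfImage (hf : IsEnvelope X.hopfRelations f) (hX : IsMagicUnitary X.proj) :
    IsHopfImage X fun i j => f (entry i j) := by
  refine ⟨⟨⟨hf.isMagicUnitary, (denseRange_iff f).1 hf.denseRange, hf.full, ?_, ?_, ?_⟩, ?_⟩,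
    fun B _ v hv => hf.exists_hom_from hv⟩
  · refine hf.exists_hom_to (hf.isMagicUnitary.conv hf.isMagicUnitary) fun B _ v hv => ?_
    obtain ⟨φ, hφ⟩ := hf.exists_hom_from hv
    obtain ⟨Δ, hΔ⟩ := hv.isQuantumPermutationAlgebra.comul
    obtain ⟨F, hF⟩ := CStarTensor.exists_map φ φ
    exact ⟨F.comp Δ, fun i j => by simp [hΔ, hF, hφ]⟩
  · exact hf.exists_hom_to (isMagicUnitary_one n) fun B _ v hv =>
      hv.isQuantumPermutationAlgebra.counit
  · refine hf.exists_hom_to hf.isMagicUnitary.op_transpose fun B _ v hv => ?_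
    obtain ⟨φ, hφ⟩ := hf.exists_hom_from hv
    obtain ⟨S, hS⟩ := hv.isQuantumPermutationAlgebra.antipode
    exact ⟨φ.opHom.comp S, fun i j => by
      rw [StarAlgHom.comp_apply, hS, StarAlgHom.opHom_op, hφ]⟩
  · exact hf.exists_hom_to hX fun B _ v hv => hv.factors

theorem MagicDecomposition.exists_isHopfImage (hX : IsMagicUnitary X.proj) :
    ∃ (A : Type w) (_ : CStarAlgebra A) (u : Matrix (Fin n) (Fin n) A), IsHopfImage X u := by
  obtain ⟨A, _, f, hf⟩ := exists_isEnvelope.{w} X.hopfRelations fun x hx => Or.inl hx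
  exact ⟨A, _, _, hf.isHopfImage hX⟩

end Existence

/-! ### Orthogonal decompositions and partitions of unity in `B(H)` -/

section Hilbert

variable {H : Type*} [NormedAddCommGroup H] [InnerProductSpace ℂ H] [CompleteSpace H]
  {ι : Type*} [Fintype ι]

theorem IsOrthogonalDecomposition.hasOrthogonalProjection {K : ι → Submodule ℂ H}
    (hK : IsOrthogonalDecomposition K) (i : ι) : (K i).HasOrthogonalProjection :=
  have : CompleteSpace (K i) := (hK.isClosed i).completeSpace_coe
  inferInstance

theorem IsOrthogonalDecomposition.isPartitionOfUnity {K : ι → Submodule ℂ H}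
    [∀ i, (K i).HasOrthogonalProjection] (hK : IsOrthogonalDecomposition K) :
    IsPartitionOfUnity fun i => (K i).starProjection where
  isStarProjection i := isStarProjection_starProjection
  orthogonal i j hij := (hK.orthogonal hij).starProjection_comp_starProjection
  sum_eq_one := by
    classical
    ext x
    have hx : x ∈ ⨆ i, K i := hK.iSup_eq_top ▸ Submodule.mem_top
    simp only [sum_apply, one_apply_eq_self]
    induction hx using Submodule.iSup_induction' with
    | zero => simp
    | add x y _ _ hx hy => simp only [map_add, Finset.sum_add_distrib, hx, hy]
    | mem i x hx =>
      rw [Finset.sum_eq_single i (fun j _ hj => ?_) (by simp)]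
      · exact Submodule.starProjection_eq_self_iff.2 hx
      · rw [Submodule.starProjection_apply_eq_zero_iff]
        exact (hK.orthogonal hj.symm) hx

namespace IsPartitionOfUnity

variable {q : ι → H →L[ℂ] H}

theorem isOrthogonalDecomposition_range (hq : IsPartitionOfUnity q) :
    IsOrthogonalDecomposition fun i => (q i).range where
  isClosed i := ContinuousLinearMap.IsIdempotentElem.isClosed_range
    (hq.isStarProjection i).isIdempotentElem
  orthogonal i j hij := by
    refine Submodule.isOrtho_iff_inner_eq.2 ?_
    rintro _ ⟨x, rfl⟩ _ ⟨y, rfl⟩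
    have h1 : inner ℂ (q i x) (q j y) = inner ℂ x ((q i * q j) y) := by
      rw [mul_apply_eq_comp, ← ContinuousLinearMap.adjoint_inner_right,
        ← ContinuousLinearMap.star_eq_adjoint, hq.star_eq]
    exact h1.trans (by rw [hq.orthogonal hij]; simp)
  iSup_eq_top := by
    refine eq_top_iff.2 fun x _ => ?_
    have hx : x = ∑ i, q i x := by
      rw [← sum_apply, hq.sum_eq_one, one_apply_eq_self]
    rw [hx]
    exact sum_mem fun i _ => Submodule.mem_iSup_of_mem i ⟨x, rfl⟩

theorem range_lift_indicator (hq : IsPartitionOfUnity q) (s : Set ι) :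
    (hq.lift (s.indicator 1)).range = ⨆ i ∈ s, (q i).range := by
  classical
  have h : hq.lift (s.indicator 1) = ∑ i, if i ∈ s then q i else 0 := by
    rw [lift_apply]
    refine Finset.sum_congr rfl fun i _ => ?_
    by_cases hi : i ∈ s <;> simp [hi]
  apply le_antisymm
  · rintro _ ⟨x, rfl⟩
    rw [h]
    simp only [ContinuousLinearMap.coe_coe, sum_apply]
    refine sum_mem fun i _ => ?_
    split_ifs with hi
    · exact Submodule.mem_iSup_of_mem i (Submodule.mem_iSup_of_mem hi ⟨x, rfl⟩)
    · simp
  · refine iSup₂_le fun i hi => ?_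
    rintro _ ⟨x, rfl⟩
    refine ⟨q i x, ?_⟩
    change (hq.lift (s.indicator 1) * q i) x = q i x
    rw [h, Finset.sum_mul, Finset.sum_eq_single i]
    · rw [if_pos hi, (hq.isStarProjection i).isIdempotentElem]
    · intro j _ hj
      split_ifs
      · exact hq.orthogonal hj
      · exact zero_mul _
    · simp

end IsPartitionOfUnity

/-- The projection onto a partial sum of an orthogonal decomposition is the image of an indicator
function under the functional calculus, since both are projections with the same range. -/
theorem IsOrthogonalDecomposition.starProjection_biSup {K : ι → Submodule ℂ H}
    [∀ i, (K i).HasOrthogonalProjection] (hK : IsOrthogonalDecomposition K) (s : Set ι)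
    (L : Submodule ℂ H) [L.HasOrthogonalProjection] (hL : L = ⨆ i ∈ s, K i) :
    L.starProjection = hK.isPartitionOfUnity.lift (s.indicator 1) := by
  have hp : IsStarProjection (s.indicator 1 : ι → ℂ) := by
    constructor
    · ext i
      by_cases hi : i ∈ s <;> simp [hi]
    · ext i
      by_cases hi : i ∈ s <;> simp [hi]
  refine ContinuousLinearMap.IsStarProjection.ext isStarProjection_starProjection
    (hp.map hK.isPartitionOfUnity.lift) ?_
  rw [hK.isPartitionOfUnity.range_lift_indicator]
  simp only [Submodule.range_starProjection, hL]

namespace MagicDecomposition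

variable {n : ℕ} (X : MagicDecomposition n H)

theorem hasOrthogonalProjection (i j : Fin n) : (X.space i j).HasOrthogonalProjection :=
  (X.row i).hasOrthogonalProjection j

theorem range_proj (i j : Fin n) : (X.proj i j).range = X.space i j :=
  have := X.hasOrthogonalProjection i j
  Submodule.range_starProjection _

theorem isMagicUnitary_proj : IsMagicUnitary X.proj :=
  have := X.hasOrthogonalProjection
  ⟨fun i => (X.row i).isPartitionOfUnity, fun j => (X.col j).isPartitionOfUnity⟩

/-- For `X = X^E`, the projections `P i j` are the images of the characteristic functions of the
blocks under the functional calculus of the decomposition `Y`. -/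
theorem proj_eq_lift {Y : ι → Submodule ℂ H} [∀ k, (Y k).HasOrthogonalProjection]
    (hY : IsOrthogonalDecomposition Y) {E : MagicPartition n ι} (h : X.space = E.subspaces Y)
    (i j : Fin n) : X.proj i j = hY.isPartitionOfUnity.lift ((E.block i j).indicator 1) :=
  have := X.hasOrthogonalProjection i j
  hY.starProjection_biSup _ (X.space i j) (by rw [h]; rfl)

end MagicDecomposition

end Hilbert

/-! ### Magic decompositions with commuting projections -/

section Commutative

/-- In a commutative algebra a magic unitary is a magic partition of the partition of unity formed
by the products `∏ j, u (σ j) j`. The products over non-injective functions in place of `σ` vanish,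
so expanding `∏ j, ∑ i, u i j = 1` shows that the sum is `1`. -/
theorem IsMagicUnitary.exists_isPartitionOfUnity {n : ℕ} {A : Type*} [CommCStarAlgebra A]
    {u : Matrix (Fin n) (Fin n) A} (hu : IsMagicUnitary u) :
    ∃ e : Equiv.Perm (Fin n) → A, IsPartitionOfUnity e ∧
      ∀ i j, u i j = ∑ σ : Equiv.Perm (Fin n), if σ j = i then e σ else 0 := by
  have hmul : ∀ (i j : Fin n) (f : Fin n → Fin n),
      u i j * ∏ k, u (f k) k = if f j = i then ∏ k, u (f k) k else 0 := by
    intro i j f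
    rw [← Finset.mul_prod_erase _ _ (Finset.mem_univ j), ← mul_assoc, hu.col_mul]
    split_ifs with h1 h2 h2 <;> simp_all
  have hinj : ∀ f : Fin n → Fin n, ¬ Function.Injective f → ∏ k, u (f k) k = 0 := by
    intro f hf
    obtain ⟨j, k, hjk, hne⟩ := Function.not_injective_iff.1 hf
    rw [← Finset.mul_prod_erase _ _ (Finset.mem_univ j),
      ← Finset.mul_prod_erase _ _ (Finset.mem_erase.2 ⟨hne.symm, Finset.mem_univ k⟩), ← mul_assoc,
      hjk, hu.row_mul, if_neg hne, zero_mul]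
  have hsum : ∑ σ : Equiv.Perm (Fin n), ∏ k, u (σ k) k = 1 := by
    have h1 : ∏ j, ∑ i, u i j = 1 := Finset.prod_eq_one fun j _ => (hu.col j).sum_eq_one
    rw [Finset.prod_univ_sum, Fintype.piFinset_univ] at h1
    rw [← h1]
    refine Finset.sum_of_injOn (fun σ : Equiv.Perm (Fin n) => (σ : Fin n → Fin n))
      DFunLike.coe_injective.injOn (by simp) (fun f _ hf => hinj f fun h => hf ?_)
      (fun _ _ => rfl)
    exact ⟨Equiv.ofBijective f (Finite.injective_iff_bijective.1 h), by simp, rfl⟩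
  have hprod : ∀ (f g : Fin n → Fin n),
      (∏ k, u (f k) k) * ∏ k, u (g k) k = if f = g then ∏ k, u (f k) k else 0 := by
    intro f g
    split_ifs with h
    · subst h
      rw [← Finset.prod_mul_distrib]
      exact Finset.prod_congr rfl fun k _ => by rw [hu.row_mul, if_pos rfl]
    · obtain ⟨j, hj⟩ := Function.ne_iff.1 h
      rw [← Finset.mul_prod_erase _ _ (Finset.mem_univ j), mul_right_comm, hmul,
        if_neg (Ne.symm hj), zero_mul]
  refine ⟨fun σ => ∏ k, u (σ k) k, .of_mul_eq (fun σ => ?_) (fun σ τ => ?_) hsum, fun i j => ?_⟩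
  · rw [star_prod]
    exact Finset.prod_congr rfl fun k _ => hu.star_eq _ _
  · rw [hprod]
    simp only [DFunLike.coe_fn_eq]
  · calc u i j = ∑ σ : Equiv.Perm (Fin n), u i j * ∏ k, u (σ k) k := by
          rw [← Finset.mul_sum, hsum, mul_one]
      _ = _ := Finset.sum_congr rfl fun σ _ => hmul i j σ

/-- A family `s` of permutations indexed by `I`, encoded as the magic partition of `I` whose
permutations `σ k` are the `s k`. -/
def MagicPartition.ofPerms {n : ℕ} {I : Type*} (s : I → Equiv.Perm (Fin n)) :
    MagicPartition n I where
  block i j := {k | s k j = i}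
  row i :=
    { disjoint := fun _ _ hj => Set.disjoint_left.2 fun k h h' =>
        hj ((s k).injective (Eq.trans h (Eq.symm h')))
      iUnion_eq_univ := Set.eq_univ_of_forall fun k =>
        Set.mem_iUnion.2 ⟨(s k).symm i, (s k).apply_symm_apply i⟩ }
  col j :=
    { disjoint := fun _ _ hi => Set.disjoint_left.2 fun _ h h' => hi (Eq.trans (Eq.symm h) h')
      iUnion_eq_univ := Set.eq_univ_of_forall fun k => Set.mem_iUnion.2 ⟨s k j, rfl⟩ }

variable {H : Type*} [NormedAddCommGroup H] [InnerProductSpace ℂ H] [CompleteSpace H] {n : ℕ}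

/-- If the `P i j` come from a commutative algebra, the images of the minimal projections of
`IsMagicUnitary.exists_isPartitionOfUnity` project onto the members of a decomposition `Y`, indexed
by all permutations, with `X = X^E` for the tautological magic partition `E`. -/
theorem MagicDecomposition.exists_magicPartition (X : MagicDecomposition n H) {A : Type*}
    [CommCStarAlgebra A] {u : Matrix (Fin n) (Fin n) A} (hu : IsMagicUnitary u)
    (ρ : A →⋆ₐ[ℂ] (H →L[ℂ] H)) (hρ : ∀ i j, ρ (u i j) = X.proj i j) :
    ∃ (N : ℕ) (Y : Fin N → Submodule ℂ H) (E : MagicPartition n (Fin N)),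
      IsOrthogonalDecomposition Y ∧ X.space = E.subspaces Y := by
  classical
  obtain ⟨e, he, hue⟩ := hu.exists_isPartitionOfUnity
  let s := (Fintype.equivFin (Equiv.Perm (Fin n))).symm
  have hq := (he.map ρ).reindex s
  refine ⟨_, _, .ofPerms s, hq.isOrthogonalDecomposition_range, funext₂ fun i j => ?_⟩
  rw [← X.range_proj, ← hρ, hue]
  refine Eq.trans ?_ (hq.range_lift_indicator _)
  rw [IsPartitionOfUnity.lift_apply, map_sum, ← s.sum_comp]
  congr 2
  refine Finset.sum_congr rfl fun k _ => ?_
  by_cases h : s k j = i <;> simp [Set.indicator, MagicPartition.ofPerms, h]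

/-- Zero subspaces can be omitted from the decomposition. -/
theorem exists_magicPartition_ne_bot {H : Type*} [NormedAddCommGroup H]
    [InnerProductSpace ℂ H] {n N : ℕ} {Y : Fin N → Submodule ℂ H}
    (E : MagicPartition n (Fin N)) (hY : IsOrthogonalDecomposition Y) :
    ∃ (M : ℕ) (Z : Fin M → Submodule ℂ H) (F : MagicPartition n (Fin M)),
      IsOrthogonalDecomposition Z ∧ (∀ k, Z k ≠ ⊥) ∧ E.subspaces Y = F.subspaces Z := by
  classical
  let s := (Fintype.equivFin {k // Y k ≠ ⊥}).symm
  have hsup : ∀ S : Set (Fin N), ⨆ k ∈ S, Y k = ⨆ k ∈ {k | (s k : Fin N) ∈ S}, Y (s k) := by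
    refine fun S => le_antisymm (iSup₂_le fun k hk => ?_)
      (iSup₂_le fun k hk => le_iSup₂_of_le (s k : Fin N) hk le_rfl)
    by_cases h : Y k = ⊥
    · simp [h]
    · refine le_iSup₂_of_le (s.symm ⟨k, h⟩) ?_ ?_ <;> simp [hk]
  refine ⟨_, fun k => Y (s k), .ofPerms fun k => E.perm (s k),
    ⟨fun k => hY.isClosed _, fun k l h => hY.orthogonal ?_, ?_⟩, fun k => (s k).2,
    funext₂ fun i j => ?_⟩
  · exact fun h' => h (s.injective (Subtype.ext h'))
  · have := hsup Set.univ
    simpa [hY.iSup_eq_top] using this.symm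
  · refine (hsup _).trans ?_
    simp only [← E.perm_apply_eq_iff]
    rfl

end Commutative

/-! ### Functions on a finite permutation group -/

theorem IsPartitionOfUnity.single {ι : Type*} [Fintype ι] [DecidableEq ι] :
    IsPartitionOfUnity fun i : ι => (Pi.single i 1 : ι → ℂ) := by
  refine .of_mul_eq (fun i => by simp) (fun i j => ?_) ?_
  · ext k
    by_cases h : i = j <;> by_cases h' : k = i <;> simp_all [Pi.single_apply]
  · exact Finset.univ_sum_single (1 : ι → ℂ)

/-- Composition with a map of index sets, as a ⋆-homomorphism of function algebras. -/
def StarAlgHom.precomp {ι κ : Type*} (m : κ → ι) : (ι → ℂ) →⋆ₐ[ℂ] (κ → ℂ) where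
  toFun f := f ∘ m
  map_one' := rfl
  map_mul' _ _ := rfl
  map_zero' := rfl
  map_add' _ _ := rfl
  commutes' _ := rfl
  map_star' _ := rfl

theorem StarAlgHom.precomp_apply {ι κ : Type*} (m : κ → ι) (f : ι → ℂ) (k : κ) :
    StarAlgHom.precomp m f k = f (m k) := rfl

section PermutationGroup

variable {n : ℕ} {Γ : Type*} [Group Γ] (π : Γ →* Equiv.Perm (Fin n))

/-- The magic unitary over the functions on a group `Γ` acting on `Fin n` by `π`. -/
def permMagicUnitary : Matrix (Fin n) (Fin n) (Γ → ℂ) := fun i j g => if π g j = i then 1 else 0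

theorem permMagicUnitary_apply (i j : Fin n) (g : Γ) :
    permMagicUnitary π i j g = if π g j = i then 1 else 0 := rfl

variable [Fintype Γ]

theorem isMagicUnitary_permMagicUnitary : IsMagicUnitary (permMagicUnitary π) := by
  refine ⟨fun i => .of_mul_eq (fun j => ?_) (fun j k => ?_) ?_,
    fun j => .of_mul_eq (fun i => ?_) (fun i k => ?_) ?_⟩
  · ext g; simp only [Pi.star_apply, permMagicUnitary_apply]; split_ifs <;> simp
  · ext g
    by_cases h : j = k
    · subst h; simp [permMagicUnitary_apply]
    · have : π g j = i → ¬ π g k = i := fun h1 h2 => h ((π g).injective (h1.trans h2.symm))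
      simp only [Pi.mul_apply, permMagicUnitary_apply, if_neg h]
      split_ifs <;> simp_all
  · ext g
    have : ∀ j, π g j = i ↔ j = (π g).symm i := fun j => (Equiv.eq_symm_apply _).symm
    simp [permMagicUnitary_apply, this]
  · ext g; simp only [Pi.star_apply, permMagicUnitary_apply]; split_ifs <;> simp
  · ext g
    by_cases h : i = k
    · subst h; simp [permMagicUnitary_apply]
    · simp only [Pi.mul_apply, permMagicUnitary_apply, if_neg h]
      split_ifs <;> simp_all
  · ext g
    simp [permMagicUnitary_apply]

variable {π}

/-- The entries generate, since `δ_g` is the product of the entries indexed by `(π g j, j)`. -/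
theorem entryAlgebra_permMagicUnitary (hπ : Function.Injective π) :
    entryAlgebra (permMagicUnitary π) = ⊤ := by
  classical
  refine eq_top_iff.2 fun f _ => ?_
  have hsingle : ∀ g : Γ, (Pi.single g 1 : Γ → ℂ) = ∏ j, permMagicUnitary π (π g j) j := by
    intro g
    ext h
    simp only [Finset.prod_apply, permMagicUnitary_apply, Pi.single_apply]
    split_ifs with hg
    · subst hg; simp
    · obtain ⟨j, hj⟩ := Equiv.ext_iff.not.1 (hπ.ne hg) |> not_forall.1
      exact (Finset.prod_eq_zero (Finset.mem_univ j) (if_neg hj)).symm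
  have hf : f = ∑ g, f g • (Pi.single g 1 : Γ → ℂ) := by
    conv_lhs => rw [← Finset.univ_sum_single f]
    exact Finset.sum_congr rfl fun g _ => by rw [← Pi.single_smul]; simp
  rw [hf]
  refine sum_mem fun g _ =>
    (entryAlgebra (permMagicUnitary π)).toSubalgebra.smul_mem ?_ _
  rw [hsingle]
  exact prod_mem fun j _ => StarAlgebra.subset_adjoin _ _ ⟨_, _, rfl⟩

variable (π) in
/-- The comultiplication of `C(Γ)`, dual to the multiplication of `Γ`: the functional calculus of
the partition of unity `δ_g ⊗ δ_h`. -/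
theorem exists_comul_permMagicUnitary :
    ∃ Δ : (Γ → ℂ) →⋆ₐ[ℂ] CStarTensor (Γ → ℂ) (Γ → ℂ), ∀ i j, Δ (permMagicUnitary π i j) =
      ∑ k, CStarTensor.tmul (permMagicUnitary π i k) (permMagicUnitary π k j) := by
  classical
  have hq := (IsPartitionOfUnity.single (ι := Γ)).tmul (IsPartitionOfUnity.single (ι := Γ))
  refine ⟨hq.lift.comp (StarAlgHom.precomp fun x : Γ × Γ => x.1 * x.2), fun i j => ?_⟩
  have hexp : ∀ i j, permMagicUnitary π i j =
      ∑ g, permMagicUnitary π i j g • (Pi.single g 1 : Γ → ℂ) := fun i j => by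
    ext h; simp [Pi.single_apply]
  have hsmul : ∀ (c d : ℂ) (a b : Γ → ℂ), CStarTensor.tmul (c • a) (d • b) =
      (c * d) • CStarTensor.tmul a b := fun c d a b => by
    simp only [CStarTensor.tmul, TensorProduct.smul_tmul_smul, map_smul]
  have hconv : ∀ g h : Γ, ∑ k, permMagicUnitary π i k g * permMagicUnitary π k j h =
      permMagicUnitary π i j (g * h) := fun g h => by
    simp [permMagicUnitary_apply]
  rw [StarAlgHom.comp_apply, IsPartitionOfUnity.lift_apply, Fintype.sum_prod_type]
  rw [Finset.sum_congr rfl fun k _ => congrArg₂ CStarTensor.tmul (hexp i k) (hexp k j)]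
  simp only [CStarTensor.sum_tmul, CStarTensor.tmul_sum, hsmul, StarAlgHom.precomp_apply, ← hconv,
    Finset.sum_smul]
  rw [Finset.sum_comm]
  exact (Finset.sum_comm.trans (Finset.sum_congr rfl fun _ _ => Finset.sum_comm)).symm

theorem isQuantumPermutationAlgebra_permMagicUnitary (hπ : Function.Injective π) :
    IsQuantumPermutationAlgebra (permMagicUnitary π) := by
  have htop := entryAlgebra_permMagicUnitary hπ
  refine ⟨isMagicUnitary_permMagicUnitary π, ?_, fun p x => ?_, exists_comul_permMagicUnitary π,
    ⟨(Pi.evalStarAlgHom ℂ (fun _ : Γ => ℂ) 1), fun i j => ?_⟩, ?_⟩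
  · rw [htop]
    exact eq_top_iff.2 (StarSubalgebra.le_topologicalClosure _)
  · -- The generated ⋆-algebra is the whole C⋆-algebra, whose norm dominates all C⋆-seminorms.
    exact (p.comap ((StarAlgHom.id ℂ (Γ → ℂ)).codRestrict _ fun y => htop ▸ trivial)).le_norm x
  · simp [permMagicUnitary_apply, eq_comm]
  · refine ⟨{ toFun := fun f => MulOpposite.op (f ∘ Inv.inv)
              map_one' := rfl
              map_mul' := fun f g => by
                rw [← MulOpposite.op_mul, mul_comm]; rfl
              map_zero' := rfl
              map_add' := fun _ _ => rfl
              commutes' := fun _ => rfl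
              map_star' := fun _ => rfl }, fun i j => congrArg MulOpposite.op ?_⟩
    ext g
    refine if_congr ?_ rfl rfl
    rw [map_inv, Equiv.Perm.inv_eq_iff_eq, eq_comm]

end PermutationGroup

/-! ### Characters of a quantum permutation algebra -/

section Characters

variable {n : ℕ} {A : Type*} [CStarAlgebra A] {u : Matrix (Fin n) (Fin n) A}

theorem IsQuantumPermutationAlgebra.hom_ext {B : Type*} [CStarAlgebra B]
    (hu : IsQuantumPermutationAlgebra u) {f g : A →⋆ₐ[ℂ] B} (h : ∀ i j, f (u i j) = g (u i j)) :
    f = g := by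
  have hcf : Continuous f := AddMonoidHomClass.continuous_of_bound f 1
    fun a => by simpa using NonUnitalStarAlgHom.norm_apply_le f a
  have hcg : Continuous g := AddMonoidHomClass.continuous_of_bound g 1
    fun a => by simpa using NonUnitalStarAlgHom.norm_apply_le g a
  have h1 : entryAlgebra u ≤ StarAlgHom.equalizer f g :=
    StarAlgHom.adjoin_le_equalizer f g (by rintro _ ⟨i, j, rfl⟩; exact h i j)
  have h2 : (entryAlgebra u).topologicalClosure ≤ StarAlgHom.equalizer f g :=
    StarSubalgebra.topologicalClosure_minimal h1 (isClosed_eq hcf hcg)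
  ext a
  exact h2 (hu.generates ▸ StarSubalgebra.mem_top)

/-- The permutations `σ` which are points of the quantum permutation group underlying `u`: those
for which there is a character of `A` mapping `u` to the matrix of `σ`. -/
def HasCharacter (u : Matrix (Fin n) (Fin n) A) (σ : Equiv.Perm (Fin n)) : Prop :=
  ∃ χ : A →⋆ₐ[ℂ] ℂ, ∀ i j, χ (u i j) = if σ j = i then 1 else 0

/-- The points form a group: products, inverses and the unit come from the comultiplication, the
antipode and the counit. -/
theorem IsQuantumPermutationAlgebra.hasCharacter_of_mem_closure
    (hu : IsQuantumPermutationAlgebra u) {S : Set (Equiv.Perm (Fin n))}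
    (hS : ∀ σ ∈ S, HasCharacter u σ) {σ : Equiv.Perm (Fin n)} (hσ : σ ∈ Subgroup.closure S) :
    HasCharacter u σ := by
  induction hσ using Subgroup.closure_induction with
  | mem σ h => exact hS σ h
  | one =>
    obtain ⟨ε, hε⟩ := hu.counit
    exact ⟨ε, fun i j => (hε i j).trans (by simp [eq_comm])⟩
  | mul σ τ _ _ hσ hτ =>
    obtain ⟨Δ, hΔ⟩ := hu.comul
    obtain ⟨χ, hχ⟩ := hσ
    obtain ⟨ψ, hψ⟩ := hτ
    obtain ⟨F, hF⟩ := CStarTensor.exists_mul χ ψ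
    exact ⟨F.comp Δ, fun i j => by simp [hΔ, hF, hχ, hψ]; rfl⟩
  | inv σ _ hσ =>
    obtain ⟨S, hS⟩ := hu.antipode
    obtain ⟨χ, hχ⟩ := hσ
    let unop : ℂᵐᵒᵖ →⋆ₐ[ℂ] ℂ :=
      { toFun := MulOpposite.unop
        map_one' := rfl
        map_mul' := fun a b => mul_comm _ _
        map_zero' := rfl
        map_add' := fun _ _ => rfl
        commutes' := fun _ => rfl
        map_star' := fun _ => rfl }
    refine ⟨unop.comp (χ.opHom.comp S), fun i j => ?_⟩
    rw [StarAlgHom.comp_apply, StarAlgHom.comp_apply, hS, StarAlgHom.opHom_op]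
    refine (hχ j i).trans ?_
    exact if_congr (by rw [Equiv.Perm.inv_eq_iff_eq, eq_comm]) rfl rfl

end Characters

/-! ### The Hopf image of `X^E` -/

section MagicPartition

variable {H : Type*} [NormedAddCommGroup H] [InnerProductSpace ℂ H] [CompleteSpace H] {n N : ℕ}
  {X : MagicDecomposition n H} {A : Type w} [CStarAlgebra A] {u : Matrix (Fin n) (Fin n) A}
  {Y : Fin N → Submodule ℂ H} {E : MagicPartition n (Fin N)}

theorem MagicPartition.perm_mem_group (k : Fin N) : E.perm k ∈ E.group :=
  Subgroup.subset_closure ⟨k, rfl⟩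

/-- `C(G)` is a factorization of `X^E`, so that its functions map to the Hopf image. -/
theorem IsHopfImage.exists_hom_of_magicPartition (hu : IsHopfImage X u)
    (hY : IsOrthogonalDecomposition Y) (h : X.space = E.subspaces Y) :
    ∃ φ : (E.group → ℂ) →⋆ₐ[ℂ] A, ∀ i j, φ (groupMagicUnitary E.group i j) = u i j := by
  have := hY.hasOrthogonalProjection
  let _ : Fintype (ULift.{w} E.group) := Fintype.ofFinite _
  let π : ULift.{w} E.group →* Equiv.Perm (Fin n) :=
    E.group.subtype.comp MulEquiv.ulift.toMonoidHom
  have hπ : Function.Injective π := Subtype.val_injective.comp ULift.down_injective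
  have hfac : IsFactorization X (permMagicUnitary π) := by
    refine ⟨isQuantumPermutationAlgebra_permMagicUnitary hπ,
      hY.isPartitionOfUnity.lift.comp
        (StarAlgHom.precomp fun k => ⟨⟨E.perm k, E.perm_mem_group k⟩⟩), fun i j => ?_⟩
    rw [X.proj_eq_lift hY h, StarAlgHom.comp_apply]
    congr 1
    ext k
    simp only [StarAlgHom.precomp_apply, permMagicUnitary_apply, Set.indicator, Pi.one_apply,
      ← E.perm_apply_eq_iff]
    rfl
  obtain ⟨φ, hφ⟩ := hu.final _ _ hfac
  exact ⟨φ.comp (StarAlgHom.precomp ULift.down), fun i j => hφ i j⟩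

/-- The map `C(G) → A` is onto because the `u i j` generate `A`, and injective because the points
of `A` form a group which contains the generators `σ k` of `G`, so that evaluation at any element
of `G` factors through `A`. -/
theorem IsHopfImage.exists_equiv_of_magicPartition (hu : IsHopfImage X u)
    (hY : IsOrthogonalDecomposition Y) (hne : ∀ k, Y k ≠ ⊥) (h : X.space = E.subspaces Y) :
    ∃ φ : A ≃⋆ₐ[ℂ] (E.group → ℂ), ∀ i j, φ (u i j) = groupMagicUnitary E.group i j := by
  have := hY.hasOrthogonalProjection
  let _ : Fintype E.group := Fintype.ofFinite _
  obtain ⟨φ, hφ⟩ := hu.exists_hom_of_magicPartition hY h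
  have hG : IsQuantumPermutationAlgebra (groupMagicUnitary E.group) :=
    isQuantumPermutationAlgebra_permMagicUnitary E.group.subtype_injective
  have hA := hu.isFactorization.isQuantumPermutationAlgebra
  have hsurj : Function.Surjective φ := by
    have hle : entryAlgebra u ≤ φ.range :=
      StarAlgebra.adjoin_le (by rintro _ ⟨i, j, rfl⟩; exact ⟨_, hφ i j⟩)
    have hcl : IsClosed (φ.range : Set A) :=
      (LinearMap.range φ.toAlgHom.toLinearMap).closed_of_finiteDimensional
    intro a
    exact StarSubalgebra.topologicalClosure_minimal hle hcl (hA.generates ▸ StarSubalgebra.mem_top)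
  -- The generators `σ k` of `G` are points of the Hopf image: on a vector `y ∈ Y k`, the image of
  -- `f ∈ C(G)` in `B(H)` acts by the scalar `f (σ k)`.
  have hgen : ∀ σ ∈ Set.range E.perm, HasCharacter u σ := by
    rintro _ ⟨k, rfl⟩
    obtain ⟨ρ, hρ⟩ := hu.isFactorization.factors
    have hρφ : ρ.comp φ = hY.isPartitionOfUnity.lift.comp
        (StarAlgHom.precomp fun k => ⟨E.perm k, E.perm_mem_group k⟩) := by
      refine hG.hom_ext fun i j => ?_
      rw [StarAlgHom.comp_apply, hφ, hρ, X.proj_eq_lift hY h, StarAlgHom.comp_apply]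
      congr 1
      ext k
      simp only [StarAlgHom.precomp_apply, groupMagicUnitary, Set.indicator, Pi.one_apply,
        ← E.perm_apply_eq_iff]
    obtain ⟨y, hy, hy0⟩ := Submodule.exists_mem_ne_zero_of_ne_bot (hne k)
    have hact : ∀ f : E.group → ℂ, ρ (φ f) y = f ⟨E.perm k, E.perm_mem_group k⟩ • y := by
      intro f
      rw [← StarAlgHom.comp_apply, hρφ, StarAlgHom.comp_apply, IsPartitionOfUnity.lift_apply,
        sum_apply, Finset.sum_eq_single k]
      · simp [StarAlgHom.precomp_apply, Submodule.starProjection_eq_self_iff.2 hy]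
      · intro l _ hl
        have : (Y l).starProjection y = 0 := by
          rw [Submodule.starProjection_apply_eq_zero_iff]
          exact (hY.orthogonal hl.symm) hy
        simp [this]
      · simp
    obtain ⟨χ, hχ⟩ := exists_starAlgHom_extension
      (Pi.evalStarAlgHom ℂ (fun _ : E.group => ℂ) ⟨E.perm k, E.perm_mem_group k⟩)
      hsurj.denseRange fun f => by
        have h1 := (ρ (φ f)).le_opNorm y
        rw [hact, norm_smul] at h1
        exact (le_of_mul_le_mul_right h1 (norm_pos_iff.2 hy0)).trans
          (NonUnitalStarAlgHom.norm_apply_le ρ _)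
    exact ⟨χ, fun i j => by rw [← hφ, hχ]; rfl⟩
  have hinj : Function.Injective φ := by
    refine (injective_iff_map_eq_zero φ).2 fun f hf => ?_
    ext g
    obtain ⟨χ, hχ⟩ := hA.hasCharacter_of_mem_closure hgen g.2
    have hχφ : χ.comp φ = Pi.evalStarAlgHom ℂ (fun _ : E.group => ℂ) g :=
      hG.hom_ext fun i j => by rw [StarAlgHom.comp_apply, hφ, hχ]; rfl
    have := DFunLike.congr_fun hχφ f
    rw [StarAlgHom.comp_apply, hf, map_zero] at this
    exact this.symm
  let e := StarAlgEquiv.ofBijective φ ⟨hinj, hsurj⟩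
  exact ⟨e.symm, fun i j => e.symm_apply_eq.2 (hφ i j).symm⟩

end MagicPartition

end

theorem theorem2p8 {H : Type*} [NormedAddCommGroup H] [InnerProductSpace ℂ H]
    [CompleteSpace H] (n : ℕ) (X : MagicDecomposition n H) :
    (∃ (A : Type w) (_ : CStarAlgebra A) (u : Matrix (Fin n) (Fin n) A), IsHopfImage X u) ∧
    ∀ (A : Type w) [CStarAlgebra A] (u : Matrix (Fin n) (Fin n) A), IsHopfImage X u →
      List.TFAE [
        ∀ a b : A, a * b = b * a,
        ∃ (N : ℕ) (Y : Fin N → Submodule ℂ H) (E : MagicPartition n (Fin N)),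
          IsOrthogonalDecomposition Y ∧ X.space = E.subspaces Y,
        ∃ (N : ℕ) (Y : Fin N → Submodule ℂ H) (E : MagicPartition n (Fin N)),
          IsOrthogonalDecomposition Y ∧ (∀ k, Y k ≠ ⊥) ∧ X.space = E.subspaces Y] ∧
      ∀ (N : ℕ) (Y : Fin N → Submodule ℂ H) (E : MagicPartition n (Fin N)),
        IsOrthogonalDecomposition Y → (∀ k, Y k ≠ ⊥) → X.space = E.subspaces Y →
          ∃ φ : A ≃⋆ₐ[ℂ] (E.group → ℂ), ∀ i j, φ (u i j) = groupMagicUnitary E.group i j := by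
  refine ⟨X.exists_isHopfImage X.isMagicUnitary_proj, fun A _ u hu => ⟨?_, fun N Y E hY hne h =>
    hu.exists_equiv_of_magicPartition hY hne h⟩⟩
  tfae_have 1 → 2 := fun hcomm => by
    let _ : CommCStarAlgebra A := { ‹CStarAlgebra A› with mul_comm := hcomm }
    obtain ⟨ρ, hρ⟩ := hu.isFactorization.factors
    exact X.exists_magicPartition
      hu.isFactorization.isQuantumPermutationAlgebra.isMagicUnitary ρ hρ
  tfae_have 2 → 3 := by
    rintro ⟨N, Y, E, hY, h⟩
    obtain ⟨M, Z, F, hZ, hne, hEF⟩ := exists_magicPartition_ne_bot E hY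
    exact ⟨M, Z, F, hZ, hne, h.trans hEF⟩
  tfae_have 3 → 1 := by
    rintro ⟨N, Y, E, hY, hne, h⟩ a b
    obtain ⟨φ, -⟩ := hu.exists_equiv_of_magicPartition hY hne h
    exact φ.injective (by rw [map_mul, map_mul, mul_comm])
  tfae_finish
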